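/- Let $\mathcal B$ be a category with finite limits and let $T=(T,m,e)$ be a cartesian monad on $\mathcal B$, i.e. $T$ preserves pullbacks and all naturality squares of the unit $e$ and the multiplication $m$ are pullbacks. A $T$-multicategory $x$ internal to $\mathcal B$ consists of a span $Tx_0\xleftarrow{d_1}x_1\xrightarrow{d_0}x_0$ in $\mathcal B$ together with an identity $s_0\colon x_0\to x_1$ and a composition $d_1\colon x_2\to x_1$, where $x_2$ is the pullback of $d_1\colon x_1\to Tx_0$ and $Td_0\colon Tx_1\to Tx_0$, with projections $d_0\colon x_2\to x_1$ and $d_2\colon x_2\to Tx_1$. For $g\colon a\to x_1$ and $f\colon a\to Tx_1$ with $d_1 g=(Td_0)f$, write $g\bullet f\colon a\to x_1$ for the composite of the composition with the induced morphism $(g,f)\colon a\to x_2$. The data must satisfy $$d_1s_0=e,\qquad d_0s_0=\mathrm{id},\qquad d_1d_1=m\circ Td_1\circ d_2\ \text{ and }\ d_0d_1=d_0d_0\ \text{ on } x_2,$$ the identity laws $(s_0d_0)\bullet e=\mathrm{id}_{x_1}=\mathrm{id}_{x_1}\bullet(Ts_0\circ d_1)$, and the associativity law $$(d_0d_0)\bullet(Td_1\circ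 d_3)=(d_1d_0)\bullet(m\circ Td_2\circ d_3)\colon x_3\to x_1,$$ where $x_3$ is the pullback of $d_2\colon x_2\to Tx_1$ and $Td_0\colon Tx_2\to Tx_1$, with projections $d_0\colon x_3\to x_2$ and $d_3\colon x_3\to Tx_2$, and where in this law $Td_1\colon Tx_2\to Tx_1$ is the image of the composition. A functor $p\colon x\to z$ of $T$-multicategories is a pair $p_0\colon x_0\to z_0$, $p_1\colon x_1\to z_1$ with $d_1p_1=(Tp_0)d_1$, $d_0p_1=p_0d_0$, $p_1s_0=s_0p_0$ and $p_1d_1=d_1p_2$ on $x_2$, where $p_2\colon x_2\to z_2$ is induced by $p_1$ and $Tp_1$; further, $p_3\colon x_3\to z_3$ denotes the morphism induced by $p_2$ and $Tp_2$. Let $\mathrm{Cat}(T,\mathcal B)$ be the category of $T$-multicategories internal to $\mathcal B$ and their functors. For a morphism $q\colon u\to w$ of a category $\mathcal C$ along which pullbacks exist, let $\mathrm{Desc}(q)$ be the category of algebras for the monad $q^*q_!$ on $\mathcal C\downarrow u$ induced by the adjunction between $q_!=q\circ(-)$ and change of base $q^*$, and let $\mathcal K^q\colon\mathcal C\downarrow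 w\to\mathrm{Desc}(q)$ be the comparison functor. The morphism $q$ is called an almost descent morphism, a descent morphism, or an effective descent morphism if pullbacks along $q$ exist and $\mathcal K^q$ is faithful, fully faithful, or an equivalence, respectively. **Theorem.** Let $p\colon x\to z$ be a functor of $T$-multicategories internal to $\mathcal B$. If $Tp_1$ is an effective descent morphism, $Tp_2$ is a descent morphism and $p_3$ is an almost descent morphism in $\mathcal B$, then $p$ is an effective descent morphism in $\mathrm{Cat}(T,\mathcal B)$. -/

import Mathlib

open CategoryTheory CategoryTheory.Limits

universe v u

namespace Descent

variable {C : Type u} [Category.{v} C]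

/-- The comparison functor `𝒦ᵖ : C ↓ Y ⥤ Desc(p)` of a morphism `p : X ⟶ Y` along which pullbacks
exist. Here `Desc(p)` is the category of algebras for the monad `p^* p_!` on `C ↓ X` induced by
the adjunction `p_! ⊣ p^*`. -/
noncomputable def comparison {X Y : C} (p : X ⟶ Y) [HasPullbacksAlong p] :
    Over Y ⥤ (Over.mapPullbackAdj p).toMonad.Algebra :=
  Monad.comparison (Over.mapPullbackAdj p)

/-- `p` is an almost descent morphism: pullbacks along `p` exist and the comparison functor is
faithful. -/
def IsAlmostDescent {X Y : C} (p : X ⟶ Y) : Prop :=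
  ∃ _ : HasPullbacksAlong p, (comparison p).Faithful

/-- `p` is a descent morphism: pullbacks along `p` exist and the comparison functor is
fully faithful. -/
def IsDescent {X Y : C} (p : X ⟶ Y) : Prop :=
  ∃ _ : HasPullbacksAlong p, (comparison p).Full ∧ (comparison p).Faithful

/-- `p` is an effective descent morphism: pullbacks along `p` exist and the comparison functor is
an equivalence of categories. -/
def IsEffectiveDescent {X Y : C} (p : X ⟶ Y) : Prop :=
  ∃ _ : HasPullbacksAlong p, (comparison p).IsEquivalence

end Descent

section

variable {B : Type u} [Category.{v} B]

/-- A monad is cartesian if its functor preserves pullbacks and all naturality squares of its unit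
and of its multiplication are pullback squares. -/
structure IsCartesianMonad (T : CategoryTheory.Monad B) : Prop where
  preservesPullbacks : PreservesLimitsOfShape WalkingCospan T.toFunctor
  unit_isPullback : ∀ {X Y : B} (f : X ⟶ Y),
    IsPullback (T.η.app X) f (T.map f) (T.η.app Y)
  mul_isPullback : ∀ {X Y : B} (f : X ⟶ Y),
    IsPullback (T.μ.app X) (T.map (T.map f)) (T.map f) (T.μ.app Y)

/-- A `T`-graph in `B`: a span `T x₀ ⟵ x₁ ⟶ x₀` with legs `d₁` (domain) and `d₀` (codomain). -/
structure TGraph (T : CategoryTheory.Monad B) where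
  /-- the object of objects -/
  x₀ : B
  /-- the object of multimorphisms -/
  x₁ : B
  /-- the domain -/
  d₁ : x₁ ⟶ T.obj x₀
  /-- the codomain -/
  d₀ : x₁ ⟶ x₀

namespace TGraph

variable {T : CategoryTheory.Monad B}

/-- A morphism of `T`-graphs. -/
@[ext]
structure Hom (x y : TGraph T) where
  /-- the component on objects -/
  f₀ : x.x₀ ⟶ y.x₀
  /-- the component on multimorphisms -/
  f₁ : x.x₁ ⟶ y.x₁
  comm_d₁ : f₁ ≫ y.d₁ = x.d₁ ≫ T.map f₀
  comm_d₀ : f₁ ≫ y.d₀ = x.d₀ ≫ f₀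

variable [HasPullbacks B]

/-- The object of composable pairs: the pullback of `d₁ : x₁ ⟶ T x₀` and `T d₀ : T x₁ ⟶ T x₀`. -/
noncomputable def x₂ (x : TGraph T) : B := pullback x.d₁ (T.map x.d₀)

/-- The projection `d₀ : x₂ ⟶ x₁`, sending a composable pair `(g, f)` to `g`. -/
noncomputable def x₂d₀ (x : TGraph T) : x.x₂ ⟶ x.x₁ := pullback.fst x.d₁ (T.map x.d₀)

/-- The projection `d₂ : x₂ ⟶ T x₁`, sending a composable pair `(g, f)` to `f`. -/
noncomputable def x₂d₂ (x : TGraph T) : x.x₂ ⟶ T.obj x.x₁ := pullback.snd x.d₁ (T.map x.d₀)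

theorem x₂_condition (x : TGraph T) : x.x₂d₀ ≫ x.d₁ = x.x₂d₂ ≫ T.map x.d₀ :=
  pullback.condition

/-- The generalized composable pair `(g, f) : a ⟶ x₂`. -/
noncomputable def pair (x : TGraph T) {a : B} (g : a ⟶ x.x₁) (f : a ⟶ T.obj x.x₁)
    (h : g ≫ x.d₁ = f ≫ T.map x.d₀) : a ⟶ x.x₂ :=
  pullback.lift g f h

@[simp]
theorem pair_d₀ (x : TGraph T) {a : B} (g : a ⟶ x.x₁) (f : a ⟶ T.obj x.x₁)
    (h : g ≫ x.d₁ = f ≫ T.map x.d₀) : x.pair g f h ≫ x.x₂d₀ = g :=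
  pullback.lift_fst _ _ _

@[simp]
theorem pair_d₂ (x : TGraph T) {a : B} (g : a ⟶ x.x₁) (f : a ⟶ T.obj x.x₁)
    (h : g ≫ x.d₁ = f ≫ T.map x.d₀) : x.pair g f h ≫ x.x₂d₂ = f :=
  pullback.lift_snd _ _ _

theorem x₂_hom_ext (x : TGraph T) {a : B} {k l : a ⟶ x.x₂}
    (h₀ : k ≫ x.x₂d₀ = l ≫ x.x₂d₀) (h₂ : k ≫ x.x₂d₂ = l ≫ x.x₂d₂) : k = l :=
  pullback.hom_ext h₀ h₂

/-- The object of composable triples: the pullback of `d₂ : x₂ ⟶ T x₁` and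
`T d₀ : T x₂ ⟶ T x₁`. -/
noncomputable def x₃ (x : TGraph T) : B := pullback x.x₂d₂ (T.map x.x₂d₀)

/-- The projection `d₀ : x₃ ⟶ x₂`, sending a composable triple `(h, g, f)` to `(h, g)`. -/
noncomputable def x₃d₀ (x : TGraph T) : x.x₃ ⟶ x.x₂ := pullback.fst x.x₂d₂ (T.map x.x₂d₀)

/-- The projection `d₃ : x₃ ⟶ T x₂`, sending a composable triple `(h, g, f)` to `(g, f)`. -/
noncomputable def x₃d₃ (x : TGraph T) : x.x₃ ⟶ T.obj x.x₂ :=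
  pullback.snd x.x₂d₂ (T.map x.x₂d₀)

theorem x₃_condition (x : TGraph T) : x.x₃d₀ ≫ x.x₂d₂ = x.x₃d₃ ≫ T.map x.x₂d₀ :=
  pullback.condition

namespace Hom

variable {x y : TGraph T} (p : Hom x y)

/-- The component of a `T`-graph morphism on composable pairs, `(g, f) ↦ (p₁ g, (T p₁) f)`. -/
noncomputable def f₂ : x.x₂ ⟶ y.x₂ :=
  y.pair (x.x₂d₀ ≫ p.f₁) (x.x₂d₂ ≫ T.map p.f₁) (by
    rw [Category.assoc, Category.assoc, p.comm_d₁, ← T.map_comp, p.comm_d₀, T.map_comp,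
      ← Category.assoc, ← Category.assoc, x.x₂_condition])

theorem f₂_d₀ : p.f₂ ≫ y.x₂d₀ = x.x₂d₀ ≫ p.f₁ := y.pair_d₀ _ _ _

theorem f₂_d₂ : p.f₂ ≫ y.x₂d₂ = x.x₂d₂ ≫ T.map p.f₁ := y.pair_d₂ _ _ _

/-- The component of a `T`-graph morphism on composable triples: the morphism induced between the
pullbacks `x₃` and `y₃` by `p₂` and `T p₂`. -/
noncomputable def f₃ : x.x₃ ⟶ y.x₃ :=
  pullback.lift (x.x₃d₀ ≫ p.f₂) (x.x₃d₃ ≫ T.map p.f₂) (by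
    rw [Category.assoc, Category.assoc, p.f₂_d₂, ← T.map_comp, p.f₂_d₀, T.map_comp,
      ← Category.assoc, ← Category.assoc, x.x₃_condition])

end Hom

end TGraph

/-- A `T`-multicategory internal to `B`: a `T`-graph with identities `s₀ : x₀ ⟶ x₁` and a
composition `d₁ : x₂ ⟶ x₁` (written `comp`) which are morphisms of spans and satisfy the identity
and associativity laws. -/
structure TMulticategory [HasPullbacks B] (T : CategoryTheory.Monad B) extends TGraph T where
  /-- the identities -/
  s₀ : x₀ ⟶ x₁
  /-- the composition -/
  comp : toTGraph.x₂ ⟶ x₁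
  s₀_d₁ : s₀ ≫ d₁ = T.η.app x₀
  s₀_d₀ : s₀ ≫ d₀ = 𝟙 x₀
  comp_d₁ : comp ≫ d₁ = toTGraph.x₂d₂ ≫ T.map d₁ ≫ T.μ.app x₀
  comp_d₀ : comp ≫ d₀ = toTGraph.x₂d₀ ≫ d₀
  /-- `1 • (e ∘ f) = f` -/
  id_comp : toTGraph.pair (d₀ ≫ s₀) (T.η.app x₁)
    (by
      rw [Category.assoc, s₀_d₁]
      exact T.η.naturality d₀) ≫ comp = 𝟙 x₁
  /-- `f • 1 = f` -/
  comp_id : toTGraph.pair (𝟙 x₁) (d₁ ≫ T.map s₀)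
    (by rw [Category.id_comp, Category.assoc, ← T.map_comp, s₀_d₀, T.map_id, Category.comp_id])
      ≫ comp = 𝟙 x₁
  /-- `h • (g •_T f) = (h • g) • (m ∘ f)` for the generic composable triple `(h, g, f)` -/
  assoc :
    toTGraph.pair (toTGraph.x₃d₀ ≫ toTGraph.x₂d₀) (toTGraph.x₃d₃ ≫ T.map comp)
      (by
        rw [Category.assoc, Category.assoc, toTGraph.x₂_condition, ← T.map_comp, comp_d₀,
          T.map_comp, ← Category.assoc, ← Category.assoc, toTGraph.x₃_condition]) ≫ comp =
    toTGraph.pair (toTGraph.x₃d₀ ≫ comp) (toTGraph.x₃d₃ ≫ T.map toTGraph.x₂d₂ ≫ T.μ.app x₁)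
      (by
        have hμ : T.map (T.map d₀) ≫ T.μ.app x₀ = T.μ.app x₁ ≫ T.map d₀ := T.μ.naturality d₀
        simp only [Category.assoc]
        rw [comp_d₁, ← hμ, ← Category.assoc, toTGraph.x₃_condition, Category.assoc,
          ← T.map_comp_assoc, ← T.map_comp_assoc, toTGraph.x₂_condition]) ≫ comp

namespace TMulticategory

variable [HasPullbacks B] {T : CategoryTheory.Monad B}

/-- A functor of internal `T`-multicategories: a morphism of `T`-graphs preserving identities and
composition. -/
@[ext]
structure Hom (x y : TMulticategory T) extends TGraph.Hom x.toTGraph y.toTGraph where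
  map_s₀ : x.s₀ ≫ f₁ = f₀ ≫ y.s₀
  map_comp : x.comp ≫ f₁ = toHom.f₂ ≫ y.comp

/-- The identity functor. -/
@[simps]
def Hom.id (x : TMulticategory T) : Hom x x where
  f₀ := 𝟙 _
  f₁ := 𝟙 _
  comm_d₁ := by simp
  comm_d₀ := by simp
  map_s₀ := by simp
  map_comp := by
    rw [Category.comp_id]
    refine (Category.id_comp _).symm.trans (congrArg (· ≫ x.comp) ?_)
    refine x.x₂_hom_ext ?_ ?_
    · rw [TGraph.Hom.f₂_d₀, Category.comp_id, Category.id_comp]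
    · rw [TGraph.Hom.f₂_d₂, T.map_id, Category.comp_id, Category.id_comp]

/-- The composite of two functors. -/
@[simps]
def Hom.comp {x y z : TMulticategory T} (p : Hom x y) (q : Hom y z) : Hom x z where
  f₀ := p.f₀ ≫ q.f₀
  f₁ := p.f₁ ≫ q.f₁
  comm_d₁ := by
    rw [Category.assoc, q.comm_d₁, ← Category.assoc, p.comm_d₁, Category.assoc, T.map_comp]
  comm_d₀ := by
    rw [Category.assoc, q.comm_d₀, ← Category.assoc, p.comm_d₀, Category.assoc]
  map_s₀ := by
    rw [← Category.assoc, p.map_s₀, Category.assoc, q.map_s₀, Category.assoc]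
  map_comp := by
    rw [← Category.assoc, p.map_comp, Category.assoc, q.map_comp, ← Category.assoc]
    refine congrArg (· ≫ z.comp) ?_
    refine z.x₂_hom_ext ?_ ?_
    · rw [TGraph.Hom.f₂_d₀, Category.assoc, TGraph.Hom.f₂_d₀, ← Category.assoc,
        TGraph.Hom.f₂_d₀, Category.assoc]
    · rw [TGraph.Hom.f₂_d₂, Category.assoc, TGraph.Hom.f₂_d₂, ← Category.assoc,
        TGraph.Hom.f₂_d₂, Category.assoc, T.map_comp]

/-- The category `Cat(T, B)` of internal `T`-multicategories and functors. -/
instance : Category (TMulticategory T) where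
  Hom := Hom
  id := Hom.id
  comp := Hom.comp
  id_comp _ := Hom.ext (Category.id_comp _) (Category.id_comp _)
  comp_id _ := Hom.ext (Category.comp_id _) (Category.comp_id _)
  assoc _ _ _ := Hom.ext (Category.assoc _ _ _) (Category.assoc _ _ _)

end TMulticategory

end

/-!
Fix `p : X ⟶ Y`. Faithfulness of the comparison functor makes all pullbacks of `p` epimorphisms,
and full faithfulness makes them effective epimorphisms (`IsAlmostDescent.isUniversalEpi`,
`IsDescent.isUniversalEffectiveEpi`; both use binary products). Essential surjectivity says that
descent data, written here as relations on generalized elements (`IsDescentRel`), are effective.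
Conversely, effective descent follows from these two properties
(`isEffectiveDescent_of_isUniversalEffectiveEpi`), without products, so this direction also applies
in `Cat(T, B)`. Both properties pass to pullbacks and to retracts of `p`.

For a functor `p : x ⟶ z` of `T`-multicategories, the naturality squares of the unit of the cartesian
monad `T` exhibit `p₁` and `p₂` as pullbacks of `T p₁` and `T p₂`, and identities and codomains
exhibit `p₀` as a retract of `p₁`. So `p₀` and `p₁` are effective descent morphisms, `p₂` is a
universal effective epimorphism, and `p₃` is a universal epimorphism.

Pullbacks in `Cat(T, B)` are levelwise on objects and multimorphisms, hence also on composable pairs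
and triples because `T` preserves pullbacks. A descent datum over `x` thus descends on objects and on
multimorphisms; the structure maps and the laws of the descended multicategory are obtained by
cancelling the effective epimorphisms on levels `0`, `1`, `2` and the epimorphism on level `3`
(`TMulticategory.descentRelsEffective`). The same levelwise argument shows that `p` is a universal
effective epimorphism in `Cat(T, B)` (`TMulticategory.isUniversalEffectiveEpi`).
-/

namespace Descent

variable {C : Type u} [Category.{v} C]

/-! ### Descent data as relations -/

/-- All pullbacks of `p` are epimorphisms. -/
def IsUniversalEpi {X Y : C} (p : X ⟶ Y) : Prop :=
  ∀ ⦃A E : C⦄ ⦃g : A ⟶ E⦄ ⦃f : A ⟶ X⦄ ⦃k : E ⟶ Y⦄, IsPullback g f k p → Epi g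

/-- All pullbacks of `p` are effective epimorphisms. In a category with kernel pairs this says that
they are regular epimorphisms. -/
def IsUniversalEffectiveEpi {X Y : C} (p : X ⟶ Y) : Prop :=
  ∀ ⦃A E : C⦄ ⦃g : A ⟶ E⦄ ⦃f : A ⟶ X⦄ ⦃k : E ⟶ Y⦄, IsPullback g f k p → EffectiveEpi g

/-- A descent datum for `p : X ⟶ Y` on `f : A ⟶ X`, given by a relation `R` on the generalized
elements of `A` instead of an action `ξ : A ×_Y X ⟶ A`: here `R r r'` means that `r' = ξ (r, f r')`.
Once the datum is `A = E ×_Y X` for some `E` over `Y`, it says that `r` and `r'` have the same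
image in `E`. -/
structure IsDescentRel {X Y A : C} (p : X ⟶ Y) (f : A ⟶ X)
    (R : ∀ ⦃S : C⦄, (S ⟶ A) → (S ⟶ A) → Prop) : Prop where
  /-- stability under change of the domain of the generalized elements -/
  comp : ∀ ⦃S S' : C⦄ (t : S' ⟶ S) ⦃r r' : S ⟶ A⦄, R r r' → R (t ≫ r) (t ≫ r')
  symm : ∀ ⦃S : C⦄ ⦃r r' : S ⟶ A⦄, R r r' → R r' r
  trans : ∀ ⦃S : C⦄ ⦃r r' r'' : S ⟶ A⦄, R r r' → R r' r'' → R r r''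
  /-- related elements lie over the same element of `Y` -/
  base : ∀ ⦃S : C⦄ ⦃r r' : S ⟶ A⦄, R r r' → r ≫ f ≫ p = r' ≫ f ≫ p
  /-- uniqueness of the element over a given element of `X` in the class of `r` -/
  eq_of_comp_eq : ∀ ⦃S : C⦄ ⦃r r' : S ⟶ A⦄, R r r' → r ≫ f = r' ≫ f → r = r'
  /-- existence of such an element, stating that the action is defined on all of `A ×_Y X` -/
  exists_lift : ∀ ⦃S : C⦄ (r : S ⟶ A) (s : S ⟶ X), r ≫ f ≫ p = s ≫ p →
    ∃ r' : S ⟶ A, R r r' ∧ r' ≫ f = s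

/-- Every descent datum for `p` on an object `A` over `X` comes from an object `E` over `Y`: `A` is
the pullback of `E` along `p`, and related elements of `A` have the same image in `E`. -/
def DescentRelsEffective {X Y : C} (p : X ⟶ Y) : Prop :=
  ∀ ⦃A : C⦄ (f : A ⟶ X) (R : ∀ ⦃S : C⦄, (S ⟶ A) → (S ⟶ A) → Prop), IsDescentRel p f R →
    ∃ (E : C) (g : A ⟶ E) (k : E ⟶ Y), IsPullback g f k p ∧
      ∀ ⦃S : C⦄ ⦃r r' : S ⟶ A⦄, R r r' → r ≫ g = r' ≫ g

/-! ### The comparison functor in terms of pullbacks -/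

/-! The objects underlying the values of `p^* p_!` and of the comparison functor are pullbacks only
up to unfolding of definitions. The statements below ascribe the unfolded types, and proofs about
such morphisms are chains of `Eq.trans`, since rewriting does not see through these types. -/

section comparison

variable {X Y : C} (p : X ⟶ Y) [HasPullbacksAlong p]

theorem comparison_obj_a_fst (E : Over Y) :
    (((comparison p).obj E).a.left : pullback (pullback.snd E.hom p ≫ p) p ⟶ pullback E.hom p) ≫
      pullback.fst E.hom p =
      pullback.fst (pullback.snd E.hom p ≫ p) p ≫ pullback.fst E.hom p := by
  have h : ((Over.mapPullbackAdj p).counit.app E).left = pullback.fst E.hom p := by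
    rw [Over.mapPullbackAdj_counit_app]; rfl
  exact (pullback.lift_fst _ _ _).trans (congrArg (_ ≫ ·) h)

theorem comparison_obj_a_snd (E : Over Y) :
    (((comparison p).obj E).a.left : pullback (pullback.snd E.hom p ≫ p) p ⟶ pullback E.hom p) ≫
      pullback.snd E.hom p =
      pullback.snd (pullback.snd E.hom p ≫ p) p :=
  pullback.lift_snd _ _ _

theorem comparison_map_f_fst {E E' : Over Y} (l : E ⟶ E') :
    (((comparison p).map l).f.left : pullback E.hom p ⟶ pullback E'.hom p) ≫
      pullback.fst E'.hom p = pullback.fst E.hom p ≫ l.left :=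
  pullback.lift_fst _ _ _

theorem comparison_map_f_snd {E E' : Over Y} (l : E ⟶ E') :
    (((comparison p).map l).f.left : pullback E.hom p ⟶ pullback E'.hom p) ≫
      pullback.snd E'.hom p = pullback.snd E.hom p :=
  pullback.lift_snd _ _ _

variable {p}

/-- The structure map `A ×_Y X ⟶ A` of an algebra for the monad `p^* p_!`, as a morphism between
the underlying objects. -/
noncomputable def action (A : (Over.mapPullbackAdj p).toMonad.Algebra) :
    pullback (A.A.hom ≫ p) p ⟶ A.A.left :=
  A.a.left

variable (A : (Over.mapPullbackAdj p).toMonad.Algebra)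

theorem action_hom : action A ≫ A.A.hom = pullback.snd (A.A.hom ≫ p) p :=
  Over.w A.a

/-- The unit law of the algebra: `ξ (a, f a) = a`. -/
theorem unit_action :
    pullback.lift (f := A.A.hom ≫ p) (g := p) (𝟙 A.A.left) A.A.hom (Category.id_comp _) ≫
      action A = 𝟙 A.A.left := by
  have h := congrArg CommaMorphism.left A.unit
  have h' : ((Over.mapPullbackAdj p).unit.app A.A).left =
      pullback.lift (f := A.A.hom ≫ p) (g := p) (𝟙 A.A.left) A.A.hom (Category.id_comp _) := by
    rw [Over.mapPullbackAdj_unit_app]; rfl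
  exact (congrArg (· ≫ action A) h').symm.trans h

theorem lift_comp_hom_action {S : C} (r : S ⟶ A.A.left)
    (h : r ≫ A.A.hom ≫ p = (r ≫ A.A.hom) ≫ p) :
    pullback.lift (f := A.A.hom ≫ p) (g := p) r (r ≫ A.A.hom) h ≫ action A = r := by
  refine Eq.trans ?_ ((congrArg (r ≫ ·) (unit_action A)).trans (Category.comp_id r))
  refine Eq.trans ?_ (Category.assoc _ _ _)
  refine congrArg (· ≫ action A) (pullback.hom_ext ?_ ?_)
  · refine (pullback.lift_fst _ _ _).trans (Eq.symm ?_)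
    refine (Category.assoc _ _ _).trans ?_
    exact (congrArg (r ≫ ·) (pullback.lift_fst _ _ _)).trans (Category.comp_id r)
  · refine (pullback.lift_snd _ _ _).trans (Eq.symm ?_)
    refine (Category.assoc _ _ _).trans ?_
    exact congrArg (r ≫ ·) (pullback.lift_snd _ _ _)

/-- The associativity law of the algebra: `ξ (ξ (r, s), s') = ξ (r, s')`. -/
theorem action_assoc {S : C} (r : S ⟶ A.A.left) (s s' : S ⟶ X) (h : r ≫ A.A.hom ≫ p = s ≫ p)
    (h' : s ≫ p = s' ≫ p) :
    pullback.lift (f := A.A.hom ≫ p) (g := p) (pullback.lift r s h ≫ action A) s'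
      (by rw [Category.assoc, reassoc_of% action_hom A, pullback.lift_snd_assoc, h']) ≫ action A =
    pullback.lift (f := A.A.hom ≫ p) (g := p) r s' (h.trans h') ≫ action A := by
  have e := congrArg CommaMorphism.left A.assoc
  have hc : ((Over.mapPullbackAdj p).counit.app ((Over.map p).obj A.A)).left =
      pullback.fst (A.A.hom ≫ p) p := by
    rw [Over.mapPullbackAdj_counit_app]; rfl
  have e' := congrArg (pullback.lift (f := pullback.snd (A.A.hom ≫ p) p ≫ p)
    (pullback.lift r s h) s' (by rw [pullback.lift_snd_assoc, h']) ≫ ·) e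
  refine Eq.trans ?_ (e'.symm.trans ?_)
  · refine Eq.trans ?_ (Category.assoc _ _ _)
    refine congrArg (· ≫ action A) (pullback.hom_ext ?_ ?_)
    · refine (pullback.lift_fst _ _ _).trans (Eq.symm ?_)
      refine (Category.assoc _ _ _).trans ?_
      refine (congrArg (_ ≫ ·) (pullback.lift_fst _ _ _)).trans ?_
      exact pullback.lift_fst_assoc _ _ _ _
    · refine (pullback.lift_snd _ _ _).trans (Eq.symm ?_)
      refine (Category.assoc _ _ _).trans ?_
      refine (congrArg (_ ≫ ·) (pullback.lift_snd _ _ _)).trans ?_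
      exact pullback.lift_snd _ _ _
  · refine (Category.assoc _ _ _).symm.trans ?_
    refine congrArg (· ≫ action A) (pullback.hom_ext ?_ ?_)
    · refine Eq.trans ?_ (pullback.lift_fst _ _ _).symm
      refine (Category.assoc _ _ _).trans ?_
      refine (congrArg (_ ≫ ·) ((pullback.lift_fst _ _ _).trans (congrArg (_ ≫ ·) hc))).trans ?_
      refine (pullback.lift_fst_assoc _ _ _ _).trans (pullback.lift_fst _ _ _)
    · refine Eq.trans ?_ (pullback.lift_snd _ _ _).symm
      refine (Category.assoc _ _ _).trans ?_
      refine (congrArg (_ ≫ ·) (pullback.lift_snd _ _ _)).trans ?_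
      exact pullback.lift_snd _ _ _

theorem mapPullback_left_fst {A A' : (Over.mapPullbackAdj p).toMonad.Algebra} (φ : A.A ⟶ A'.A) :
    (((Over.mapPullbackAdj p).toMonad.map φ).left :
      pullback (A.A.hom ≫ p) p ⟶ pullback (A'.A.hom ≫ p) p) ≫ pullback.fst (A'.A.hom ≫ p) p =
      pullback.fst (A.A.hom ≫ p) p ≫ φ.left :=
  pullback.lift_fst _ _ _

theorem mapPullback_left_snd {A A' : (Over.mapPullbackAdj p).toMonad.Algebra} (φ : A.A ⟶ A'.A) :
    (((Over.mapPullbackAdj p).toMonad.map φ).left :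
      pullback (A.A.hom ≫ p) p ⟶ pullback (A'.A.hom ≫ p) p) ≫ pullback.snd (A'.A.hom ≫ p) p =
      pullback.snd (A.A.hom ≫ p) p :=
  pullback.lift_snd _ _ _

theorem map_left_comp_action {A A' : (Over.mapPullbackAdj p).toMonad.Algebra} (φ : A ⟶ A') :
    (((Over.mapPullbackAdj p).toMonad.map φ.f).left :
      pullback (A.A.hom ≫ p) p ⟶ pullback (A'.A.hom ≫ p) p) ≫ action A' =
      action A ≫ φ.f.left :=
  congrArg CommaMorphism.left φ.h

end comparison

/-! ### Cancellation from faithfulness and fullness -/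

/-- A morphism `E ⟶ W` is the same as a morphism over `Y` from `E` to `W ⨯ Y`, so faithfulness of the
comparison functor makes every pullback of `p` right cancellable. -/
theorem IsAlmostDescent.isUniversalEpi [HasBinaryProducts C] {X Y : C} {p : X ⟶ Y}
    (hp : IsAlmostDescent p) : IsUniversalEpi p := by
  obtain ⟨_, hK⟩ := hp
  intro A E g f k sq
  refine ⟨fun {W} l l' h => ?_⟩
  let L : (E ⟶ W) → (Over.mk k ⟶ Over.mk (prod.snd : W ⨯ Y ⟶ Y)) := fun l =>
    Over.homMk (prod.lift l k) (prod.lift_snd _ _)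
  have hfst : pullback.fst k p ≫ l = pullback.fst k p ≫ l' := by
    have : pullback.fst k p = sq.isoPullback.inv ≫ g := by simp
    rw [this, Category.assoc, h, Category.assoc]
  have hL : L l = L l' := by
    refine hK.map_injective (Monad.Algebra.Hom.ext (Over.OverMorphism.ext ?_))
    refine pullback.hom_ext ((comparison_map_f_fst p _).trans (Eq.trans ?_
      (comparison_map_f_fst p _).symm)) ((comparison_map_f_snd p _).trans
      (comparison_map_f_snd p _).symm)
    change pullback.fst k p ≫ prod.lift l k = pullback.fst k p ≫ prod.lift l' k
    exact (prod.comp_lift _ _ _).trans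
      ((congrArg (prod.lift · _) hfst).trans (prod.comp_lift _ _ _).symm)
  have hlift : prod.lift l k = prod.lift l' k := congrArg CommaMorphism.left hL
  rw [← prod.lift_fst l k, hlift, prod.lift_fst]

/-- A morphism out of `E ×_Y X` that coequalizes the kernel pair of the projection to `E` is the same
as a homomorphism of algebras from `𝒦ᵖ E` to `𝒦ᵖ (W ⨯ Y)`, which fullness descends to `E`. -/
theorem IsDescent.isUniversalEffectiveEpi [HasBinaryProducts C] {X Y : C} {p : X ⟶ Y}
    (hp : IsDescent p) : IsUniversalEffectiveEpi p := by
  have hepi : IsUniversalEpi p := IsAlmostDescent.isUniversalEpi ⟨hp.1, hp.2.2⟩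
  obtain ⟨_, hK, -⟩ := hp
  intro A E g f k sq
  have hg : Epi g := hepi sq
  have key : ∀ {W : C} (h : A ⟶ W),
      (∀ {S : C} (r r' : S ⟶ A), r ≫ g = r' ≫ g → r ≫ h = r' ≫ h) → ∃ l : E ⟶ W, g ≫ l = h := by
    intro W h hh
    let α : pullback k p ⟶ A := sq.isoPullback.inv
    have hα : α ≫ g = pullback.fst k p := sq.isoPullback_inv_fst
    let E₁ := Over.mk k
    let E₂ := Over.mk (prod.snd : W ⨯ Y ⟶ Y)
    -- `m` is the transpose of `h`; the condition on `h` makes it a homomorphism of algebras.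
    let m : pullback k p ⟶ pullback (prod.snd : W ⨯ Y ⟶ Y) p :=
      pullback.lift (prod.lift (α ≫ h) (pullback.fst k p ≫ k)) (pullback.snd k p)
        (by rw [prod.lift_snd, pullback.condition])
    have hm₁ : m ≫ pullback.fst _ _ = prod.lift (α ≫ h) (pullback.fst k p ≫ k) :=
      pullback.lift_fst _ _ _
    have hm₂ : m ≫ pullback.snd _ _ = pullback.snd k p := pullback.lift_snd _ _ _
    let M : ((comparison p).obj E₁).A ⟶ ((comparison p).obj E₂).A := Over.homMk m hm₂
    let φ : (comparison p).obj E₁ ⟶ (comparison p).obj E₂ :=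
      { f := M
        h := by
          refine Over.OverMorphism.ext (pullback.hom_ext ?_ ?_)
          · refine (Category.assoc _ _ _).trans ?_
            refine (congrArg (_ ≫ ·) (comparison_obj_a_fst p E₂)).trans ?_
            refine (Category.assoc _ _ _).symm.trans ?_
            refine (congrArg (· ≫ _) (mapPullback_left_fst M)).trans ?_
            refine (Category.assoc _ _ _).trans ?_
            refine (congrArg (_ ≫ ·) hm₁).trans (Eq.symm ?_)
            refine (Category.assoc _ _ _).trans ?_
            refine (congrArg (_ ≫ ·) hm₁).trans ?_
            have e := comparison_obj_a_fst p E₁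
            refine Limits.prod.hom_ext ?_ ?_
            · refine (Category.assoc _ _ _).trans ?_
              refine (congrArg (_ ≫ ·) (prod.lift_fst _ _)).trans (Eq.symm ?_)
              refine (Category.assoc _ _ _).trans ?_
              refine (congrArg (_ ≫ ·) (prod.lift_fst _ _)).trans (Eq.symm ?_)
              refine (Category.assoc _ _ _).symm.trans (Eq.trans ?_ (Category.assoc _ _ _))
              refine hh _ _ ?_
              refine (Category.assoc _ _ _).trans (Eq.trans ?_ (Category.assoc _ _ _).symm)
              exact (congrArg (_ ≫ ·) hα).trans (e.trans (congrArg (_ ≫ ·) hα).symm)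
            · refine (Category.assoc _ _ _).trans ?_
              refine (congrArg (_ ≫ ·) (prod.lift_snd _ _)).trans (Eq.symm ?_)
              refine (Category.assoc _ _ _).trans ?_
              refine (congrArg (_ ≫ ·) (prod.lift_snd _ _)).trans (Eq.symm ?_)
              refine (Category.assoc _ _ _).symm.trans (Eq.trans ?_ (Category.assoc _ _ _))
              exact congrArg (· ≫ k) e
          · refine (Category.assoc _ _ _).trans ?_
            refine (congrArg (_ ≫ ·) (comparison_obj_a_snd p E₂)).trans ?_
            refine (mapPullback_left_snd M).trans (Eq.symm ?_)
            refine (Category.assoc _ _ _).trans ?_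
            refine (congrArg (_ ≫ ·) hm₂).trans ?_
            exact comparison_obj_a_snd p E₁ }
    obtain ⟨l, hl⟩ := hK.map_surjective φ
    have hl' : pullback.fst k p ≫ l.left = m ≫ pullback.fst _ _ := by
      rw [← show ((comparison p).map l).f.left = m from by rw [hl]; rfl]
      exact (comparison_map_f_fst p l).symm
    refine ⟨l.left ≫ (prod.fst : W ⨯ Y ⟶ W), ?_⟩
    have hg' : g = sq.isoPullback.hom ≫ pullback.fst k p := by simp
    have : pullback.fst k p ≫ l.left ≫ (prod.fst : W ⨯ Y ⟶ W) = α ≫ h := by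
      rw [reassoc_of% hl']
      exact (Category.assoc _ _ _).symm.trans
        ((congrArg (· ≫ prod.fst) hm₁).trans (prod.lift_fst _ _))
    rw [hg', Category.assoc]
    refine (congrArg (_ ≫ ·) this).trans ?_
    simp [α]
  exact ⟨⟨{ desc := fun h hh => (key h hh).choose
            fac := fun h hh => (key h hh).choose_spec
            uniq := fun h hh m hm => by
              rw [← cancel_epi g, hm, (key h hh).choose_spec] }⟩⟩

/-! ### Algebras and descent relations -/

theorem IsDescentRel.eq_of_rel {X Y A : C} {p : X ⟶ Y} {f : A ⟶ X}
    {R : ∀ ⦃S : C⦄, (S ⟶ A) → (S ⟶ A) → Prop} (hR : IsDescentRel p f R)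
    ⦃S : C⦄ ⦃r r' r'' : S ⟶ A⦄ (h : R r r') (h' : R r r'') (hf : r' ≫ f = r'' ≫ f) : r' = r'' :=
  hR.eq_of_comp_eq (hR.trans (hR.symm h) h') hf

theorem IsDescentRel.refl {X Y A : C} {p : X ⟶ Y} {f : A ⟶ X}
    {R : ∀ ⦃S : C⦄, (S ⟶ A) → (S ⟶ A) → Prop} (hR : IsDescentRel p f R)
    ⦃S : C⦄ (r : S ⟶ A) : R r r := by
  obtain ⟨r', h, -⟩ := hR.exists_lift r (r ≫ f) (Category.assoc _ _ _).symm
  exact hR.trans h (hR.symm h)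

/-- A descent relation is represented by the action sending `(a, s)` to the element related to `a`
whose image in `X` is `s`. -/
theorem IsDescentRel.exists_algebra {X Y A : C} {p : X ⟶ Y} [HasPullbacksAlong p] {f : A ⟶ X}
    {R : ∀ ⦃S : C⦄, (S ⟶ A) → (S ⟶ A) → Prop} (hR : IsDescentRel p f R) :
    ∃ (a : (Over.mapPullbackAdj p).toMonad.obj (Over.mk f) ⟶ Over.mk f)
      (hu : (Over.mapPullbackAdj p).toMonad.η.app (Over.mk f) ≫ a = 𝟙 _)
      (ha : (Over.mapPullbackAdj p).toMonad.μ.app (Over.mk f) ≫ a =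
        (Over.mapPullbackAdj p).toMonad.map a ≫ a),
      R (pullback.fst (f ≫ p) p)
        (action (Monad.Algebra.mk (T := (Over.mapPullbackAdj p).toMonad) (Over.mk f) a hu ha)) := by
  obtain ⟨ξ, hξ, hξf⟩ := hR.exists_lift (pullback.fst (f ≫ p) p) (pullback.snd (f ≫ p) p)
    pullback.condition
  let a : (Over.mapPullbackAdj p).toMonad.obj (Over.mk f) ⟶ Over.mk f := Over.homMk ξ hξf
  have hc : ((Over.mapPullbackAdj p).counit.app ((Over.map p).obj (Over.mk f))).left =
      pullback.fst (f ≫ p) p := by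
    rw [Over.mapPullbackAdj_counit_app]; rfl
  refine ⟨a, Over.OverMorphism.ext ?_, Over.OverMorphism.ext ?_, hξ⟩
  · have h' : ((Over.mapPullbackAdj p).unit.app (Over.mk f)).left =
        pullback.lift (f := f ≫ p) (g := p) (𝟙 A) f (Category.id_comp _) := by
      rw [Over.mapPullbackAdj_unit_app]; rfl
    refine (congrArg (· ≫ ξ) h').trans (Eq.symm ?_)
    have := hR.comp (pullback.lift (f := f ≫ p) (g := p) (𝟙 A) f (Category.id_comp _)) hξ
    rw [pullback.lift_fst] at this
    refine hR.eq_of_comp_eq this ?_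
    rw [Category.assoc, hξf, pullback.lift_snd]
    exact Category.id_comp f
  · let t₁ : pullback (pullback.snd (f ≫ p) p ≫ p) p ⟶ pullback (f ≫ p) p :=
      ((Over.mapPullbackAdj p).toMonad.μ.app (Over.mk f)).left
    let t₂ : pullback (pullback.snd (f ≫ p) p ≫ p) p ⟶ pullback (f ≫ p) p :=
      ((Over.mapPullbackAdj p).toMonad.map a).left
    change t₁ ≫ ξ = t₂ ≫ ξ
    have h₁ : t₁ ≫ pullback.fst _ _ = pullback.fst _ _ ≫ pullback.fst _ _ :=
      (pullback.lift_fst _ _ _).trans (congrArg (_ ≫ ·) hc)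
    have h₁' : t₁ ≫ pullback.snd _ _ = pullback.snd _ _ := pullback.lift_snd _ _ _
    have h₂ : t₂ ≫ pullback.fst _ _ = pullback.fst _ _ ≫ ξ := pullback.lift_fst _ _ _
    have h₂' : t₂ ≫ pullback.snd _ _ = pullback.snd _ _ := pullback.lift_snd _ _ _
    have e₁ := hR.comp t₁ hξ
    have e₂ := hR.comp t₂ hξ
    rw [h₁] at e₁
    rw [h₂] at e₂
    refine hR.eq_of_rel e₁ (hR.trans (hR.comp _ hξ) e₂) ?_
    rw [Category.assoc, Category.assoc, hξf, h₁', h₂']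

theorem IsEffectiveDescent.descentRelsEffective {X Y : C} {p : X ⟶ Y}
    (hp : IsEffectiveDescent p) : DescentRelsEffective p := by
  obtain ⟨_, hK⟩ := hp
  intro A f R hR
  obtain ⟨a, hu, ha, hRa⟩ := hR.exists_algebra
  let 𝔸 : (Over.mapPullbackAdj p).toMonad.Algebra := ⟨Over.mk f, a, hu, ha⟩
  let E := (comparison p).objPreimage 𝔸
  let i := (comparison p).objObjPreimageIso 𝔸
  let j : A ⟶ pullback E.hom p := i.inv.f.left
  let j' : pullback E.hom p ⟶ A := i.hom.f.left
  have hj : j ≫ j' = 𝟙 _ :=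
    congrArg (fun m : 𝔸 ⟶ 𝔸 => CommaMorphism.left m.f) i.inv_hom_id
  have hj' : j' ≫ j = 𝟙 _ :=
    congrArg (fun m : (comparison p).obj E ⟶ (comparison p).obj E => CommaMorphism.left m.f)
      i.hom_inv_id
  have hjs : j ≫ pullback.snd E.hom p = f := Over.w i.inv.f
  have hact : action 𝔸 ≫ j ≫ pullback.fst E.hom p =
      pullback.fst (f ≫ p) p ≫ j ≫ pullback.fst E.hom p := by
    have h := (map_left_comp_action i.inv).symm
    refine (Category.assoc _ _ _).symm.trans ((congrArg (· ≫ pullback.fst E.hom p) h).trans ?_)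
    refine (Category.assoc _ _ _).trans ?_
    refine (congrArg (_ ≫ ·) (comparison_obj_a_fst p E)).trans ?_
    refine (Category.assoc _ _ _).symm.trans ?_
    refine (congrArg (· ≫ pullback.fst E.hom p) (mapPullback_left_fst i.inv.f)).trans ?_
    exact Category.assoc _ _ _
  refine ⟨E.left, j ≫ pullback.fst E.hom p, E.hom, ?_, ?_⟩
  · refine IsPullback.of_iso_pullback ⟨?_⟩ ⟨j, j', hj, hj'⟩ rfl hjs
    rw [Category.assoc, pullback.condition, reassoc_of% hjs]
  · intro S r r' h
    have hb : r ≫ f ≫ p = (r' ≫ f) ≫ p := by rw [hR.base h, Category.assoc]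
    have h₁ := hR.comp (pullback.lift r (r' ≫ f) hb) hRa
    rw [pullback.lift_fst] at h₁
    have h₂ : r' = pullback.lift r (r' ≫ f) hb ≫ action 𝔸 := by
      refine hR.eq_of_rel h h₁ ?_
      refine Eq.trans ?_ (Category.assoc _ _ _).symm
      exact ((congrArg (_ ≫ ·) (action_hom 𝔸)).trans (pullback.lift_snd _ _ _)).symm
    rw [h₂]
    refine Eq.trans ?_ (Category.assoc _ _ _).symm
    refine Eq.trans ?_ (congrArg (_ ≫ ·) hact).symm
    exact (pullback.lift_fst_assoc _ _ _ _).symm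

/-- The relation `r' = ξ (r, f r')` of an algebra. It is stated through a generalized element `t` of
`A ×_Y X`, whose second component is then forced to be `f r'`. -/
theorem isDescentRel_action {X Y : C} {p : X ⟶ Y} [HasPullbacksAlong p]
    (A : (Over.mapPullbackAdj p).toMonad.Algebra) :
    IsDescentRel p A.A.hom fun S r r' =>
      ∃ t : S ⟶ pullback (A.A.hom ≫ p) p, t ≫ pullback.fst _ _ = r ∧ t ≫ action A = r' := by
  have hlift : ∀ {S : C} (t : S ⟶ pullback (A.A.hom ≫ p) p) (h),
      t = pullback.lift (t ≫ pullback.fst _ _) (t ≫ pullback.snd _ _) h := fun t h =>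
    pullback.hom_ext (pullback.lift_fst _ _ _).symm (pullback.lift_snd _ _ _).symm
  constructor
  · rintro S S' t r r' ⟨u, rfl, rfl⟩
    exact ⟨t ≫ u, Category.assoc _ _ _, Category.assoc _ _ _⟩
  · rintro S r r' ⟨u, rfl, rfl⟩
    have h : (u ≫ pullback.fst _ _) ≫ A.A.hom ≫ p = (u ≫ pullback.snd _ _) ≫ p := by
      rw [Category.assoc, Category.assoc, pullback.condition]
    have h' : (u ≫ pullback.snd _ _) ≫ p = ((u ≫ pullback.fst _ _) ≫ A.A.hom) ≫ p := by
      rw [← h, Category.assoc, Category.assoc, Category.assoc]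
    have e := action_assoc A (u ≫ pullback.fst _ _) (u ≫ pullback.snd _ _) _ h h'
    simp only [← hlift] at e
    exact ⟨_, pullback.lift_fst _ _ _, e.trans (lift_comp_hom_action A _ _)⟩
  · rintro S r r' r'' ⟨u, rfl, hu⟩ ⟨u', hu', rfl⟩
    have h : (u ≫ pullback.fst _ _) ≫ A.A.hom ≫ p = (u ≫ pullback.snd _ _) ≫ p := by
      rw [Category.assoc, Category.assoc, pullback.condition]
    have h' : (u ≫ pullback.snd _ _) ≫ p = (u' ≫ pullback.snd _ _) ≫ p := by
      rw [Category.assoc u', ← pullback.condition (f := A.A.hom ≫ p),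
        reassoc_of% hu', ← hu, Category.assoc, Category.assoc, reassoc_of% action_hom A]
    refine ⟨pullback.lift (u ≫ pullback.fst _ _) (u' ≫ pullback.snd _ _) (h.trans h'),
      pullback.lift_fst _ _ _, ?_⟩
    have e := action_assoc A (u ≫ pullback.fst _ _) (u ≫ pullback.snd _ _) _ h h'
    rw [← e]
    refine congrArg (· ≫ action A) (pullback.hom_ext ?_ ?_)
    · rw [pullback.lift_fst, ← hlift, hu, hu']
    · rw [pullback.lift_snd]
  · rintro S r r' ⟨u, rfl, rfl⟩
    rw [Category.assoc, Category.assoc, reassoc_of% action_hom A, pullback.condition]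
  · rintro S r r' ⟨u, rfl, rfl⟩ h
    rw [Category.assoc _ (action A), action_hom] at h
    refine (lift_comp_hom_action A (u ≫ pullback.fst _ _) (Category.assoc _ _ _).symm).symm.trans ?_
    exact congrArg (· ≫ action A)
      (pullback.hom_ext (pullback.lift_fst _ _ _) ((pullback.lift_snd _ _ _).trans h))
  · intro S r s h
    refine ⟨pullback.lift r s h ≫ action A, ⟨_, pullback.lift_fst _ _ _, rfl⟩, ?_⟩
    rw [Category.assoc, action_hom, pullback.lift_snd]

/-- The sufficient condition for effective descent. Faithfulness and fullness come from cancelling and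
descending along the projections `E ×_Y X ⟶ E`; essential surjectivity is the effectiveness of the
descent relation of an algebra. -/
theorem isEffectiveDescent_of_isUniversalEffectiveEpi {X Y : C} {p : X ⟶ Y} [HasPullbacksAlong p]
    (hp : IsUniversalEffectiveEpi p) (hp' : DescentRelsEffective p) : IsEffectiveDescent p := by
  have heff : ∀ E : Over Y, EffectiveEpi (pullback.fst E.hom p) := fun E =>
    hp (IsPullback.of_hasPullback E.hom p)
  refine ⟨inferInstance, ⟨⟨?_⟩, ⟨?_⟩, ⟨?_⟩⟩⟩
  · intro E E' l l' h
    refine Over.OverMorphism.ext ?_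
    have := heff E
    rw [← cancel_epi (pullback.fst E.hom p)]
    rw [← comparison_map_f_fst, ← comparison_map_f_fst, h]
  · intro E E' φ
    let m : pullback E.hom p ⟶ pullback E'.hom p := φ.f.left
    have hm : m ≫ pullback.snd _ _ = pullback.snd _ _ := Over.w φ.f
    have := heff E
    have hcond : ∀ {S : C} (r r' : S ⟶ pullback E.hom p),
        r ≫ pullback.fst E.hom p = r' ≫ pullback.fst E.hom p →
        r ≫ m ≫ pullback.fst E'.hom p = r' ≫ m ≫ pullback.fst E'.hom p := by
      intro S r r' h
      -- The free action moves `r` to `r'` along `t`, and `φ` is compatible with the actions.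
      let t : S ⟶ pullback (pullback.snd E.hom p ≫ p) p := pullback.lift r (r' ≫ pullback.snd _ _)
        (by rw [← pullback.condition, reassoc_of% h, Category.assoc, pullback.condition])
      let b : pullback (pullback.snd E.hom p ≫ p) p ⟶ pullback E.hom p :=
        action ((comparison p).obj E)
      have hb : b ≫ m ≫ pullback.fst E'.hom p = pullback.fst _ _ ≫ m ≫ pullback.fst E'.hom p := by
        have h := (map_left_comp_action φ).symm
        refine (Category.assoc _ _ _).symm.trans
          ((congrArg (· ≫ pullback.fst E'.hom p) h).trans ?_)
        refine (Category.assoc _ _ _).trans ?_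
        refine (congrArg (_ ≫ ·) (comparison_obj_a_fst p E')).trans ?_
        refine (Category.assoc _ _ _).symm.trans ?_
        refine (congrArg (· ≫ pullback.fst E'.hom p) (mapPullback_left_fst φ.f)).trans ?_
        exact Category.assoc _ _ _
      have ht : t ≫ b = r' := by
        refine pullback.hom_ext ?_ ?_
        · refine (Category.assoc _ _ _).trans ?_
          refine (congrArg (_ ≫ ·) (comparison_obj_a_fst p E)).trans ?_
          exact (pullback.lift_fst_assoc _ _ _ _).trans h
        · refine (Category.assoc _ _ _).trans ?_
          refine (congrArg (_ ≫ ·) (comparison_obj_a_snd p E)).trans ?_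
          exact (pullback.lift_snd _ _ _)
      rw [← ht, Category.assoc, hb, pullback.lift_fst_assoc]
    let l := EffectiveEpi.desc (pullback.fst E.hom p) (m ≫ pullback.fst E'.hom p) hcond
    have hl : pullback.fst E.hom p ≫ l = m ≫ pullback.fst E'.hom p := EffectiveEpi.fac _ _ _
    refine ⟨Over.homMk l ?_, ?_⟩
    · rw [← cancel_epi (pullback.fst E.hom p), reassoc_of% hl, pullback.condition,
        reassoc_of% hm, pullback.condition]
    · refine Monad.Algebra.Hom.ext (Over.OverMorphism.ext (pullback.hom_ext ?_ ?_))
      · exact (comparison_map_f_fst p _).trans hl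
      · exact (comparison_map_f_snd p _).trans hm.symm
  · intro A
    obtain ⟨E, g, k, sq, hg⟩ := hp' _ _ (isDescentRel_action A)
    have hact : action A ≫ g = pullback.fst _ _ ≫ g :=
      (hg ⟨𝟙 _, Category.id_comp _, Category.id_comp _⟩).symm
    let i : A.A ≅ ((comparison p).obj (Over.mk k)).A :=
      Over.isoMk sq.isoPullback sq.isoPullback_hom_snd
    refine ⟨Over.mk k, ⟨(Monad.Algebra.isoMk i (Over.OverMorphism.ext
      (pullback.hom_ext ?_ ?_))).symm⟩⟩
    · refine (Category.assoc _ _ _).trans ?_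
      refine (congrArg (_ ≫ ·) (comparison_obj_a_fst p _)).trans ?_
      refine (Category.assoc _ _ _).symm.trans ?_
      refine (congrArg (· ≫ pullback.fst k p) (mapPullback_left_fst i.hom)).trans ?_
      refine (Category.assoc _ _ _).trans ?_
      refine (congrArg (_ ≫ ·) sq.isoPullback_hom_fst).trans (Eq.symm ?_)
      refine (Category.assoc _ _ _).trans ?_
      exact (congrArg (_ ≫ ·) sq.isoPullback_hom_fst).trans hact
    · refine (Category.assoc _ _ _).trans ?_
      refine (congrArg (_ ≫ ·) (comparison_obj_a_snd p _)).trans ?_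
      refine (mapPullback_left_snd i.hom).trans (Eq.symm ?_)
      refine (Category.assoc _ _ _).trans ?_
      exact (congrArg (_ ≫ ·) sq.isoPullback_hom_snd).trans (action_hom A)

/-! ### Stability under pullbacks, retracts and functors -/

theorem IsUniversalEffectiveEpi.of_isPullback {X Y X' Y' : C} {p : X ⟶ Y} {p' : X' ⟶ Y'}
    {h : X' ⟶ X} {l : Y' ⟶ Y} (hp : IsUniversalEffectiveEpi p) (sq : IsPullback p' h l p) :
    IsUniversalEffectiveEpi p' :=
  fun _ _ _ _ _ sq' => hp (sq'.paste_vert sq)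

/-- Once a descent datum is effective, relatedness is equality in the descended object. -/
theorem IsDescentRel.rel_iff_of_isPullback {X Y A E : C} {p : X ⟶ Y} {f : A ⟶ X}
    {R : ∀ ⦃S : C⦄, (S ⟶ A) → (S ⟶ A) → Prop} (hR : IsDescentRel p f R) {g : A ⟶ E} {k : E ⟶ Y}
    (sq : IsPullback g f k p) (hg : ∀ ⦃S : C⦄ ⦃r r' : S ⟶ A⦄, R r r' → r ≫ g = r' ≫ g)
    ⦃S : C⦄ (r r' : S ⟶ A) : R r r' ↔ r ≫ g = r' ≫ g := by
  refine ⟨fun h => hg h, fun h => ?_⟩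
  obtain ⟨r'', h₁, h₂⟩ := hR.exists_lift r (r' ≫ f) (by
    rw [← sq.w, reassoc_of% h, sq.w, Category.assoc])
  obtain rfl : r'' = r' := sq.hom_ext ((hg h₁).symm.trans h) h₂
  exact h₁

/-- Descent data for a pullback `p'` of `p` are descent data for `p`. The descended object lives over
`Y`, and its map to `Y` lifts to `Y'` because `A ⟶ E` is an effective epimorphism. -/
theorem DescentRelsEffective.of_isPullback {X Y X' Y' : C} {p : X ⟶ Y} {p' : X' ⟶ Y'}
    {h : X' ⟶ X} {l : Y' ⟶ Y} (hp : IsUniversalEffectiveEpi p) (hp' : DescentRelsEffective p)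
    (sq : IsPullback p' h l p) : DescentRelsEffective p' := by
  intro A f R hR
  have hR' : IsDescentRel p (f ≫ h) R :=
    { comp := hR.comp
      symm := hR.symm
      trans := hR.trans
      base := fun S r r' hr => by
        have := hR.base hr
        rw [Category.assoc, ← sq.w, reassoc_of% this]
      eq_of_comp_eq := fun S r r' hr e => by
        refine hR.eq_of_comp_eq hr (sq.hom_ext ?_ ?_)
        · rw [Category.assoc, Category.assoc, hR.base hr]
        · rw [Category.assoc, Category.assoc, e]
      exists_lift := fun S r s e => by
        have e' : (r ≫ f ≫ p') ≫ l = s ≫ p := by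
          rw [Category.assoc, Category.assoc, sq.w, ← e, Category.assoc]
        obtain ⟨r', h₁, h₂⟩ := hR.exists_lift r (sq.lift _ _ e') (by rw [sq.lift_fst])
        exact ⟨r', h₁, by rw [reassoc_of% h₂, sq.lift_snd]⟩ }
  obtain ⟨E, g, k, sqE, hg⟩ := hp' _ _ hR'
  have := hp sqE
  have hk : ∀ {S : C} (r r' : S ⟶ A), r ≫ g = r' ≫ g → r ≫ f ≫ p' = r' ≫ f ≫ p' :=
    fun r r' e => hR.base ((hR'.rel_iff_of_isPullback sqE hg r r').2 e)
  have hfac := EffectiveEpi.fac g (f ≫ p') hk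
  refine ⟨E, g, EffectiveEpi.desc g (f ≫ p') hk, IsPullback.of_bot ?_ hfac sq, hg⟩
  convert sqE
  rw [← cancel_epi g, reassoc_of% hfac, sqE.w, sq.w, Category.assoc]

variable [HasPullbacks C]

/-- A pullback `g : A ⟶ E` of the retract `p'` is itself a retract of a pullback of `p`, namely of the
one along `E ×_{Y'} Y ⟶ Y`; the retraction on targets is the projection to `E`. -/
theorem IsUniversalEffectiveEpi.of_retract {X Y X' Y' : C} {p : X ⟶ Y} {p' : X' ⟶ Y'}
    (hp : IsUniversalEffectiveEpi p) (e : RetractArrow p' p) : IsUniversalEffectiveEpi p' := by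
  intro A E g f k sq
  have hE := IsPullback.of_hasPullback k e.r.right
  have hA := IsPullback.of_hasPullback (pullback.snd k e.r.right) p
  have hσ : 𝟙 E ≫ k = (k ≫ e.i.right) ≫ e.r.right := by
    rw [Category.assoc, e.retract_right]; simp
  have hτ : (g ≫ hE.lift _ _ hσ) ≫ pullback.snd k e.r.right = (f ≫ e.i.left) ≫ p := by
    rw [Category.assoc, hE.lift_snd, reassoc_of% sq.w, Category.assoc, e.i_w]
  have hρ : (pullback.fst (pullback.snd k e.r.right) p ≫ pullback.fst k e.r.right) ≫ k =
      (pullback.snd (pullback.snd k e.r.right) p ≫ e.r.left) ≫ p' := by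
    rw [Category.assoc, hE.w, reassoc_of% hA.w, Category.assoc, e.r_w]
  have := hp hA
  have hρg := sq.lift_fst _ _ hρ
  have hτρ : hA.lift _ _ hτ ≫ sq.lift _ _ hρ = 𝟙 A := by
    refine sq.hom_ext ?_ ?_
    · rw [Category.assoc, sq.lift_fst, hA.lift_fst_assoc, Category.assoc, hE.lift_fst]; simp
    · rw [Category.assoc, sq.lift_snd, hA.lift_snd_assoc, Category.assoc, e.retract_left]; simp
  have hg : Epi g := by
    refine ⟨fun m m' h => ?_⟩
    have : pullback.fst k e.r.right ≫ m = pullback.fst k e.r.right ≫ m' := by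
      rw [← cancel_epi (pullback.fst (pullback.snd k e.r.right) p), ← reassoc_of% hρg, h,
        reassoc_of% hρg]
    have := congrArg (hE.lift _ _ hσ ≫ ·) this
    simpa using this
  have key : ∀ {W : C} (h : A ⟶ W),
      (∀ {S : C} (r r' : S ⟶ A), r ≫ g = r' ≫ g → r ≫ h = r' ≫ h) → ∃ m : E ⟶ W, g ≫ m = h := by
    intro W h hh
    obtain ⟨d, hd⟩ : ∃ d, pullback.fst (pullback.snd k e.r.right) p ≫ d = sq.lift _ _ hρ ≫ h :=
      ⟨_, EffectiveEpi.fac _ _ fun r r' hr => by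
        rw [← Category.assoc, ← Category.assoc]
        refine hh _ _ ?_
        rw [Category.assoc, Category.assoc, hρg, reassoc_of% hr]⟩
    refine ⟨hE.lift _ _ hσ ≫ d, ?_⟩
    rw [← Category.assoc, ← hA.lift_fst _ _ hτ, Category.assoc, hd, reassoc_of% hτρ]
  exact ⟨⟨{ desc := fun h hh => (key h hh).choose
            fac := fun h hh => (key h hh).choose_spec
            uniq := fun h hh m hm => by
              rw [← cancel_epi g, hm, (key h hh).choose_spec] }⟩⟩

/-- A descent datum for the retract `p'` is pulled back along the retraction to one for `p`; the object
`E'` that the latter descends to is then pulled back along the section. -/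
theorem DescentRelsEffective.of_retract {X Y X' Y' : C} {p : X ⟶ Y} {p' : X' ⟶ Y'}
    (hp : DescentRelsEffective p) (e : RetractArrow p' p) : DescentRelsEffective p' := by
  intro A f R hR
  have hA := IsPullback.of_hasPullback f e.r.left
  set α := pullback.fst f e.r.left
  set f₁ := pullback.snd f e.r.left
  -- The datum on `A ×_{X'} X` acts on the component in `A` and is determined by the one in `X`.
  have hR' : IsDescentRel p f₁ fun S u u' => R (u ≫ α) (u' ≫ α) ∧ u ≫ f₁ ≫ p = u' ≫ f₁ ≫ p :=
    { comp := fun S S' t r r' h => by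
        refine ⟨?_, by rw [Category.assoc, h.2, Category.assoc]⟩
        rw [Category.assoc, Category.assoc]
        exact hR.comp t h.1
      symm := fun S r r' h => ⟨hR.symm h.1, h.2.symm⟩
      trans := fun S r r' r'' h h' => ⟨hR.trans h.1 h'.1, h.2.trans h'.2⟩
      base := fun S r r' h => h.2
      eq_of_comp_eq := fun S r r' h h' => by
        refine hA.hom_ext (hR.eq_of_comp_eq h.1 ?_) h'
        rw [Category.assoc, hA.w, reassoc_of% h', Category.assoc, hA.w]
      exists_lift := fun S u s h => by
        obtain ⟨a, h₁, h₂⟩ := hR.exists_lift (u ≫ α) (s ≫ e.r.left) (by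
          rw [Category.assoc, Category.assoc, reassoc_of% hA.w, e.r_w, reassoc_of% h])
        refine ⟨hA.lift a s h₂, ⟨?_, ?_⟩, hA.lift_snd _ _ _⟩
        · rwa [hA.lift_fst]
        · rw [hA.lift_snd_assoc, h] }
  obtain ⟨E', g', k', sq, hg⟩ := hp _ _ hR'
  have hE := IsPullback.of_hasPullback k' e.i.right
  -- `(𝟙, f ≫ i) : A ⟶ A ×_{X'} X` is the section over `i : X' ⟶ X` of the projection to `A`.
  have hτ : 𝟙 A ≫ f = (f ≫ e.i.left) ≫ e.r.left := by
    rw [Category.assoc, e.retract_left]; simp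
  have hgw : (hA.lift _ _ hτ ≫ g') ≫ k' = (f ≫ p') ≫ e.i.right := by
    rw [Category.assoc, sq.w, hA.lift_snd_assoc, Category.assoc, Category.assoc, e.i_w]
  refine ⟨_, hE.lift _ _ hgw, pullback.snd k' e.i.right, IsPullback.mk' (hE.lift_snd _ _ _) ?_ ?_,
    ?_⟩
  · intro S a b h h'
    have h₁ : a ≫ hA.lift _ _ hτ = b ≫ hA.lift _ _ hτ := by
      refine sq.hom_ext ?_ ?_
      · rw [Category.assoc, ← hE.lift_fst _ _ hgw, reassoc_of% h, Category.assoc, hE.lift_fst]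
      · rw [Category.assoc, hA.lift_snd, reassoc_of% h', Category.assoc, hA.lift_snd]
    have := congrArg (· ≫ α) h₁
    simpa only [Category.assoc, hA.lift_fst, Category.comp_id] using this
  · intro S ε s h
    have h₁ : (ε ≫ pullback.fst k' e.i.right) ≫ k' = (s ≫ e.i.left) ≫ p := by
      rw [Category.assoc, hE.w, reassoc_of% h, Category.assoc, e.i_w]
    obtain ⟨a, ha₁, ha₂⟩ := sq.exists_lift _ _ h₁
    have haf : (a ≫ α) ≫ f = s := by
      rw [Category.assoc, hA.w, reassoc_of% ha₂, e.retract_left]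
      exact Category.comp_id s
    have haτ : (a ≫ α) ≫ hA.lift _ _ hτ = a := by
      refine hA.hom_ext ?_ ?_
      · rw [Category.assoc, hA.lift_fst, Category.comp_id]
      · rw [Category.assoc, hA.lift_snd, ← Category.assoc, haf, ha₂]
    refine ⟨a ≫ α, hE.hom_ext ?_ ?_, haf⟩
    · rw [Category.assoc, hE.lift_fst, ← Category.assoc, haτ, ha₁]
    · rw [Category.assoc, hE.lift_snd, ← Category.assoc, haf, h]
  · intro S r r' h
    refine hE.hom_ext ?_ ?_
    · rw [Category.assoc, hE.lift_fst, Category.assoc, hE.lift_fst, ← Category.assoc,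
        ← Category.assoc]
      refine hg ⟨?_, ?_⟩
      · rw [Category.assoc, hA.lift_fst, Category.assoc, hA.lift_fst, Category.comp_id,
          Category.comp_id]
        exact h
      · rw [Category.assoc, hA.lift_snd_assoc, Category.assoc, Category.assoc,
          hA.lift_snd_assoc, Category.assoc, e.i_w, reassoc_of% hR.base h]
    · rw [Category.assoc, hE.lift_snd, Category.assoc, hE.lift_snd, hR.base h]

/-- A pullback-preserving functor carries descent data to descent data. The relation on the image is
the one represented by the images of the two projections `π` and `ξ` from the object `P` of related
pairs. -/
theorem IsDescentRel.map {D : Type*} [Category* D] (F : C ⥤ D)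
    (hF : ∀ ⦃P X Y Z : C⦄ ⦃a : P ⟶ X⦄ ⦃b : P ⟶ Y⦄ ⦃c : X ⟶ Z⦄ ⦃d : Y ⟶ Z⦄, IsPullback a b c d →
      IsPullback (F.map a) (F.map b) (F.map c) (F.map d))
    {X Y A : C} {p : X ⟶ Y} {f : A ⟶ X}
    {R : ∀ ⦃S : C⦄, (S ⟶ A) → (S ⟶ A) → Prop} (hR : IsDescentRel p f R)
    {P : C} {π ξ : P ⟶ A} (sq : IsPullback π (ξ ≫ f) (f ≫ p) p) (hξ : R π ξ) :
    IsDescentRel (F.map p) (F.map f) fun S r r' =>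
      ∃ t : S ⟶ F.obj P, t ≫ F.map π = r ∧ t ≫ F.map ξ = r' := by
  have sqF := hF sq
  have hu : ∀ {S : C} (t : S ⟶ P) (r : S ⟶ A), R (t ≫ π) r → t ≫ ξ ≫ f = r ≫ f → t ≫ ξ = r :=
    fun t r h h' => hR.eq_of_rel (hR.comp t hξ) h (by rw [Category.assoc, h'])
  constructor
  · rintro S S' t r r' ⟨w, rfl, rfl⟩
    exact ⟨t ≫ w, Category.assoc _ _ _, Category.assoc _ _ _⟩
  · rintro S r r' ⟨w, rfl, rfl⟩
    have hσ : ξ ≫ f ≫ p = (π ≫ f) ≫ p := by rw [← hR.base hξ, Category.assoc]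
    have h₁ := sq.lift_fst _ _ hσ
    have h₂ : sq.lift _ _ hσ ≫ ξ = π :=
      hu _ _ (by rw [h₁]; exact hR.symm hξ) (sq.lift_snd _ _ hσ)
    refine ⟨w ≫ F.map (sq.lift _ _ hσ), ?_, ?_⟩
    · rw [Category.assoc, ← F.map_comp, h₁]
    · rw [Category.assoc, ← F.map_comp, h₂]
  · rintro S r r' r'' ⟨w, rfl, hw⟩ ⟨w', hw', rfl⟩
    -- The object of triples `(r, r', s)` with `r` related to `r'` and `s` over the same element of `Y`;
    -- moving `r` or `r'` to `s` gives the same element of `A`.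
    have hQ := IsPullback.of_hasPullback (ξ ≫ f ≫ p) p
    set q₁ := pullback.fst (ξ ≫ f ≫ p) p
    set q₂ := pullback.snd (ξ ≫ f ≫ p) p
    have hθ : (q₁ ≫ π) ≫ f ≫ p = q₂ ≫ p := by
      rw [Category.assoc, hR.base hξ, hQ.w]
    have hθ' : (q₁ ≫ ξ) ≫ f ≫ p = q₂ ≫ p := by
      rw [Category.assoc, hQ.w]
    have h₁ := sq.lift_fst _ _ hθ
    have h₂ : sq.lift _ _ hθ ≫ ξ = sq.lift _ _ hθ' ≫ ξ := by
      refine hu _ _ ?_ ?_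
      · rw [h₁]
        have := hR.comp (sq.lift _ _ hθ') hξ
        rw [sq.lift_fst] at this
        exact hR.trans (hR.comp q₁ hξ) this
      · rw [sq.lift_snd, Category.assoc, sq.lift_snd]
    have hq : w ≫ F.map (ξ ≫ f ≫ p) = (w' ≫ F.map (ξ ≫ f)) ≫ F.map p := by
      rw [Category.assoc, ← sqF.w, reassoc_of% hw', ← hw, Category.assoc, ← F.map_comp]
    obtain ⟨q, hq₁, hq₂⟩ := (hF hQ).exists_lift _ _ hq
    refine ⟨q ≫ F.map (sq.lift _ _ hθ), ?_, ?_⟩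
    · rw [Category.assoc, ← F.map_comp, h₁, F.map_comp, reassoc_of% hq₁]
    · rw [Category.assoc, ← F.map_comp, h₂, F.map_comp, ← Category.assoc]
      refine congrArg (· ≫ F.map ξ) (sqF.hom_ext ?_ ?_)
      · rw [Category.assoc, ← F.map_comp, sq.lift_fst, F.map_comp, reassoc_of% hq₁, hw, hw']
      · rw [Category.assoc, ← F.map_comp, sq.lift_snd, hq₂]
  · rintro S r r' ⟨w, rfl, rfl⟩
    simp only [Category.assoc, ← F.map_comp, hR.base hξ]
  · rintro S r r' ⟨w, rfl, rfl⟩ h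
    have hδ : 𝟙 A ≫ f ≫ p = f ≫ p := Category.id_comp _
    have h₂ : sq.lift _ _ hδ ≫ ξ = 𝟙 A :=
      hu _ _ (by rw [sq.lift_fst]; exact hR.refl _) (by rw [sq.lift_snd, Category.id_comp])
    have : w = (w ≫ F.map π) ≫ F.map (sq.lift _ _ hδ) := by
      refine sqF.hom_ext ?_ ?_
      · rw [Category.assoc, Category.assoc, ← F.map_comp, sq.lift_fst, F.map_id, Category.comp_id]
      · rw [Category.assoc, ← F.map_comp, sq.lift_snd, h, Category.assoc, F.map_comp]
    conv_rhs => rw [this]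
    rw [Category.assoc, ← F.map_comp, h₂, F.map_id, Category.comp_id]
  · intro S r s h
    rw [← F.map_comp] at h
    exact ⟨_, ⟨sqF.lift r s h, sqF.lift_fst _ _ _, rfl⟩, by
      rw [Category.assoc, ← F.map_comp, sqF.lift_snd]⟩

end Descent

/-! ### Levels of pullback squares -/

section cube

variable {C : Type*} [Category* C]

/-- Pullbacks commute with pullbacks: a commutative square between pullbacks of cospans is a pullback
as soon as it is one on the three vertices of the cospans. -/
theorem isPullback_of_cube
    {A AU AV AW E EU EV EW X XU XV XW Z ZU ZV ZW : C}
    {aU : A ⟶ AU} {aV : A ⟶ AV} {aU' : AU ⟶ AW} {aV' : AV ⟶ AW} (hA : IsPullback aU aV aU' aV')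
    {eU : E ⟶ EU} {eV : E ⟶ EV} {eU' : EU ⟶ EW} {eV' : EV ⟶ EW} (hE : IsPullback eU eV eU' eV')
    {xU : X ⟶ XU} {xV : X ⟶ XV} {xU' : XU ⟶ XW} {xV' : XV ⟶ XW} (hX : IsPullback xU xV xU' xV')
    {zU : Z ⟶ ZU} {zV : Z ⟶ ZV} {zU' : ZU ⟶ ZW} {zV' : ZV ⟶ ZW} (hZ : IsPullback zU zV zU' zV')
    {gU : AU ⟶ EU} {fU : AU ⟶ XU} {kU : EU ⟶ ZU} {pU : XU ⟶ ZU} (hU : IsPullback gU fU kU pU)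
    {gV : AV ⟶ EV} {fV : AV ⟶ XV} {kV : EV ⟶ ZV} {pV : XV ⟶ ZV} (hV : IsPullback gV fV kV pV)
    {gW : AW ⟶ EW} {fW : AW ⟶ XW} {kW : EW ⟶ ZW} {pW : XW ⟶ ZW} (hW : IsPullback gW fW kW pW)
    {g : A ⟶ E} {f : A ⟶ X} {k : E ⟶ Z} {p : X ⟶ Z}
    (hgU : g ≫ eU = aU ≫ gU) (hgV : g ≫ eV = aV ≫ gV)
    (hfU : f ≫ xU = aU ≫ fU) (hfV : f ≫ xV = aV ≫ fV)
    (hkU : k ≫ zU = eU ≫ kU) (hkV : k ≫ zV = eV ≫ kV)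
    (hpU : p ≫ zU = xU ≫ pU) (hpV : p ≫ zV = xV ≫ pV)
    (hgU' : gU ≫ eU' = aU' ≫ gW) (hgV' : gV ≫ eV' = aV' ≫ gW)
    (hfU' : fU ≫ xU' = aU' ≫ fW) (hfV' : fV ≫ xV' = aV' ≫ fW) :
    IsPullback g f k p := by
  refine IsPullback.mk' ?_ ?_ ?_
  · refine hZ.hom_ext ?_ ?_
    · rw [Category.assoc, hkU, reassoc_of% hgU, hU.w, Category.assoc, hpU, reassoc_of% hfU]
    · rw [Category.assoc, hkV, reassoc_of% hgV, hV.w, Category.assoc, hpV, reassoc_of% hfV]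
  · intro S r r' h h'
    refine hA.hom_ext (hU.hom_ext ?_ ?_) (hV.hom_ext ?_ ?_)
    · rw [Category.assoc, ← hgU, reassoc_of% h, hgU, Category.assoc]
    · rw [Category.assoc, ← hfU, reassoc_of% h', hfU, Category.assoc]
    · rw [Category.assoc, ← hgV, reassoc_of% h, hgV, Category.assoc]
    · rw [Category.assoc, ← hfV, reassoc_of% h', hfV, Category.assoc]
  · intro S ε s h
    obtain ⟨u, hu₁, hu₂⟩ := hU.exists_lift (ε ≫ eU) (s ≫ xU) (by
      rw [Category.assoc, Category.assoc, ← hkU, ← hpU, reassoc_of% h])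
    obtain ⟨w, hw₁, hw₂⟩ := hV.exists_lift (ε ≫ eV) (s ≫ xV) (by
      rw [Category.assoc, Category.assoc, ← hkV, ← hpV, reassoc_of% h])
    obtain ⟨r, hr₁, hr₂⟩ := hA.exists_lift u w (by
      refine hW.hom_ext ?_ ?_
      · rw [Category.assoc, Category.assoc, ← hgU', ← hgV', reassoc_of% hu₁, reassoc_of% hw₁, hE.w]
      · rw [Category.assoc, Category.assoc, ← hfU', ← hfV', reassoc_of% hu₂, reassoc_of% hw₂, hX.w])
    refine ⟨r, hE.hom_ext ?_ ?_, hX.hom_ext ?_ ?_⟩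
    · rw [Category.assoc, hgU, reassoc_of% hr₁, hu₁]
    · rw [Category.assoc, hgV, reassoc_of% hr₂, hw₁]
    · rw [Category.assoc, hfU, reassoc_of% hr₁, hu₂]
    · rw [Category.assoc, hfV, reassoc_of% hr₂, hw₂]

end cube

section multicategories

variable {B : Type u} [Category.{v} B] {T : CategoryTheory.Monad B}

theorem IsCartesianMonad.map_isPullback (hT : IsCartesianMonad T) {P X Y Z : B} {a : P ⟶ X}
    {b : P ⟶ Y} {c : X ⟶ Z} {d : Y ⟶ Z} (sq : IsPullback a b c d) :
    IsPullback (T.map a) (T.map b) (T.map c) (T.map d) :=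
  have := hT.preservesPullbacks
  sq.map T.toFunctor

namespace TGraph

variable [HasPullbacks B]

theorem isPullback_x₂ (x : TGraph T) : IsPullback x.x₂d₀ x.x₂d₂ x.d₁ (T.map x.d₀) :=
  IsPullback.of_hasPullback _ _

theorem isPullback_x₃ (x : TGraph T) : IsPullback x.x₃d₀ x.x₃d₃ x.x₂d₂ (T.map x.x₂d₀) :=
  IsPullback.of_hasPullback _ _

namespace Hom

section

variable {x y : TGraph T} (φ : Hom x y)

theorem f₃_d₀ : φ.f₃ ≫ y.x₃d₀ = x.x₃d₀ ≫ φ.f₂ := pullback.lift_fst _ _ _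

theorem f₃_d₃ : φ.f₃ ≫ y.x₃d₃ = x.x₃d₃ ≫ T.map φ.f₂ := pullback.lift_snd _ _ _

theorem f₂_eq_comp {z : TGraph T} (ψ : Hom y z) (χ : Hom x z) (h : χ.f₁ = φ.f₁ ≫ ψ.f₁) :
    χ.f₂ = φ.f₂ ≫ ψ.f₂ := by
  refine z.x₂_hom_ext ?_ ?_
  · rw [f₂_d₀, Category.assoc, f₂_d₀, reassoc_of% φ.f₂_d₀, h]
  · rw [f₂_d₂, Category.assoc, f₂_d₂, reassoc_of% φ.f₂_d₂, h, T.map_comp]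

variable {s : x.x₀ ⟶ x.x₁} {s' : y.x₀ ⟶ y.x₁} {c : x.x₂ ⟶ x.x₁} {c' : y.x₂ ⟶ y.x₁}

/-- Morphisms of `T`-graphs that respect the (not yet lawful) compositions `c` and `c'` respect
`•`-composites. Applied to the two sides of each law, this moves the law along jointly monic or
epic families of morphisms. -/
theorem pair_comp_naturality (hc : c ≫ φ.f₁ = φ.f₂ ≫ c') {a b : B} {g : a ⟶ x.x₁}
    {f : a ⟶ T.obj x.x₁} {g' : b ⟶ y.x₁} {f' : b ⟶ T.obj y.x₁} {t : a ⟶ b}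
    (hg : g ≫ φ.f₁ = t ≫ g') (hf : f ≫ T.map φ.f₁ = t ≫ f') (h h') :
    (x.pair g f h ≫ c) ≫ φ.f₁ = t ≫ y.pair g' f' h' ≫ c' := by
  rw [Category.assoc, hc, ← Category.assoc, ← Category.assoc]
  refine congrArg (· ≫ c') (y.x₂_hom_ext ?_ ?_)
  · rw [Category.assoc, φ.f₂_d₀, ← Category.assoc, pair_d₀, hg, Category.assoc, pair_d₀]
  · rw [Category.assoc, φ.f₂_d₂, ← Category.assoc, pair_d₂, hf, Category.assoc, pair_d₂]

theorem id_comp_naturality (hs : s ≫ φ.f₁ = φ.f₀ ≫ s') (hc : c ≫ φ.f₁ = φ.f₂ ≫ c') (h h') :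
    (x.pair (x.d₀ ≫ s) (T.η.app x.x₁) h ≫ c) ≫ φ.f₁ =
      φ.f₁ ≫ y.pair (y.d₀ ≫ s') (T.η.app y.x₁) h' ≫ c' := by
  refine φ.pair_comp_naturality (t := φ.f₁) hc ?_ (T.η.naturality φ.f₁).symm _ _
  rw [Category.assoc, hs, ← reassoc_of% φ.comm_d₀]

theorem comp_id_naturality (hs : s ≫ φ.f₁ = φ.f₀ ≫ s') (hc : c ≫ φ.f₁ = φ.f₂ ≫ c') (h h') :
    (x.pair (𝟙 x.x₁) (x.d₁ ≫ T.map s) h ≫ c) ≫ φ.f₁ =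
      φ.f₁ ≫ y.pair (𝟙 y.x₁) (y.d₁ ≫ T.map s') h' ≫ c' := by
  refine φ.pair_comp_naturality hc ((Category.id_comp _).trans (Category.comp_id _).symm) ?_ _ _
  rw [Category.assoc, ← T.map_comp, hs, reassoc_of% φ.comm_d₁, T.map_comp]

theorem assoc_left_naturality (hc : c ≫ φ.f₁ = φ.f₂ ≫ c') (h h') :
    (x.pair (x.x₃d₀ ≫ x.x₂d₀) (x.x₃d₃ ≫ T.map c) h ≫ c) ≫ φ.f₁ =
      φ.f₃ ≫ y.pair (y.x₃d₀ ≫ y.x₂d₀) (y.x₃d₃ ≫ T.map c') h' ≫ c' := by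
  refine φ.pair_comp_naturality hc ?_ ?_ _ _
  · rw [Category.assoc, ← φ.f₂_d₀, ← reassoc_of% φ.f₃_d₀]
  · rw [Category.assoc, ← T.map_comp, hc, reassoc_of% φ.f₃_d₃, T.map_comp]

theorem assoc_right_naturality (hc : c ≫ φ.f₁ = φ.f₂ ≫ c') (h h') :
    (x.pair (x.x₃d₀ ≫ c) (x.x₃d₃ ≫ T.map x.x₂d₂ ≫ T.μ.app x.x₁) h ≫ c) ≫ φ.f₁ =
      φ.f₃ ≫ y.pair (y.x₃d₀ ≫ c') (y.x₃d₃ ≫ T.map y.x₂d₂ ≫ T.μ.app y.x₁) h' ≫ c' := by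
  have hμ : T.map (T.map φ.f₁) ≫ T.μ.app y.x₁ = T.μ.app x.x₁ ≫ T.map φ.f₁ := T.μ.naturality φ.f₁
  refine φ.pair_comp_naturality hc ?_ ?_ _ _
  · rw [Category.assoc, hc, ← reassoc_of% φ.f₃_d₀]
  · rw [Category.assoc, Category.assoc, ← hμ, reassoc_of% φ.f₃_d₃, ← T.map_comp_assoc φ.f₂,
      φ.f₂_d₂, T.map_comp_assoc]

theorem comp_d₁_naturality :
    (x.x₂d₂ ≫ T.map x.d₁ ≫ T.μ.app x.x₀) ≫ T.map φ.f₀ =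
      φ.f₂ ≫ y.x₂d₂ ≫ T.map y.d₁ ≫ T.μ.app y.x₀ := by
  have hμ : T.map (T.map φ.f₀) ≫ T.μ.app y.x₀ = T.μ.app x.x₀ ≫ T.map φ.f₀ := T.μ.naturality φ.f₀
  rw [Category.assoc, Category.assoc, ← hμ, ← T.map_comp_assoc, ← φ.comm_d₁, T.map_comp_assoc,
    reassoc_of% φ.f₂_d₂]

end

section

variable {a e x z : TGraph T} {g : Hom a e} {f : Hom a x} {k : Hom e z} {p : Hom x z}

theorem isPullback_f₂ (hT : IsCartesianMonad T) (h₀ : IsPullback g.f₀ f.f₀ k.f₀ p.f₀)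
    (h₁ : IsPullback g.f₁ f.f₁ k.f₁ p.f₁) : IsPullback g.f₂ f.f₂ k.f₂ p.f₂ :=
  isPullback_of_cube a.isPullback_x₂ e.isPullback_x₂ x.isPullback_x₂ z.isPullback_x₂
    h₁ (hT.map_isPullback h₁) (hT.map_isPullback h₀)
    g.f₂_d₀ g.f₂_d₂ f.f₂_d₀ f.f₂_d₂ k.f₂_d₀ k.f₂_d₂ p.f₂_d₀ p.f₂_d₂
    g.comm_d₁ (by rw [← T.map_comp, g.comm_d₀, T.map_comp])
    f.comm_d₁ (by rw [← T.map_comp, f.comm_d₀, T.map_comp])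

theorem isPullback_f₃ (hT : IsCartesianMonad T) (h₀ : IsPullback g.f₀ f.f₀ k.f₀ p.f₀)
    (h₁ : IsPullback g.f₁ f.f₁ k.f₁ p.f₁) : IsPullback g.f₃ f.f₃ k.f₃ p.f₃ :=
  have h₂ := isPullback_f₂ hT h₀ h₁
  isPullback_of_cube a.isPullback_x₃ e.isPullback_x₃ x.isPullback_x₃ z.isPullback_x₃
    h₂ (hT.map_isPullback h₂) (hT.map_isPullback h₁)
    g.f₃_d₀ g.f₃_d₃ f.f₃_d₀ f.f₃_d₃ k.f₃_d₀ k.f₃_d₃ p.f₃_d₀ p.f₃_d₃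
    g.f₂_d₂ (by rw [← T.map_comp, g.f₂_d₀, T.map_comp])
    f.f₂_d₂ (by rw [← T.map_comp, f.f₂_d₀, T.map_comp])

end

end Hom

end TGraph

/-! ### Pullbacks of multicategories -/

namespace TMulticategory

variable [HasPullbacks B]

theorem hom_ext {x y : TMulticategory T} {f g : x ⟶ y} (h₀ : f.f₀ = g.f₀) (h₁ : f.f₁ = g.f₁) :
    f = g :=
  Hom.ext h₀ h₁

theorem comp_f₂ {x y z : TMulticategory T} (f : x ⟶ y) (g : y ⟶ z) :
    (f ≫ g).f₂ = f.f₂ ≫ g.f₂ :=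
  TGraph.Hom.f₂_eq_comp _ _ _ rfl

variable (T) in
/-- The object-of-objects functor `Cat(T, B) ⥤ B`. -/
def objects : TMulticategory T ⥤ B where
  obj x := x.x₀
  map f := f.f₀
  map_id _ := rfl
  map_comp _ _ := rfl

variable (T) in
/-- The object-of-multimorphisms functor `Cat(T, B) ⥤ B`. -/
def arrows : TMulticategory T ⥤ B where
  obj x := x.x₁
  map f := f.f₁
  map_id _ := rfl
  map_comp _ _ := rfl

theorem isPullback_of_levels {a x y z : TMulticategory T} {φ : a ⟶ x} {ψ : a ⟶ y} {f : x ⟶ z}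
    {g : y ⟶ z} (hT : IsCartesianMonad T) (h₀ : IsPullback φ.f₀ ψ.f₀ f.f₀ g.f₀)
    (h₁ : IsPullback φ.f₁ ψ.f₁ f.f₁ g.f₁) : IsPullback φ ψ f g := by
  have hT₀ := hT.map_isPullback h₀
  refine IsPullback.mk' (hom_ext h₀.w h₁.w) ?_ ?_
  · intro c r r' h h'
    exact hom_ext (h₀.hom_ext (congrArg (objects T).map h) (congrArg (objects T).map h'))
      (h₁.hom_ext (congrArg (arrows T).map h) (congrArg (arrows T).map h'))
  · intro c r s h
    obtain ⟨l₀, hl₀, hl₀'⟩ := h₀.exists_lift r.f₀ s.f₀ (congrArg (objects T).map h)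
    obtain ⟨l₁, hl₁, hl₁'⟩ := h₁.exists_lift r.f₁ s.f₁ (congrArg (arrows T).map h)
    let l : TGraph.Hom c.toTGraph a.toTGraph :=
      { f₀ := l₀
        f₁ := l₁
        comm_d₁ := by
          refine hT₀.hom_ext ?_ ?_
          · rw [Category.assoc, ← φ.comm_d₁, reassoc_of% hl₁, Category.assoc, ← T.map_comp, hl₀,
              r.comm_d₁]
          · rw [Category.assoc, ← ψ.comm_d₁, reassoc_of% hl₁', Category.assoc, ← T.map_comp, hl₀',
              s.comm_d₁]
        comm_d₀ := by
          refine h₀.hom_ext ?_ ?_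
          · rw [Category.assoc, ← φ.comm_d₀, reassoc_of% hl₁, Category.assoc, hl₀, r.comm_d₀]
          · rw [Category.assoc, ← ψ.comm_d₀, reassoc_of% hl₁', Category.assoc, hl₀', s.comm_d₀] }
    have hr : r.f₂ = l.f₂ ≫ φ.f₂ := TGraph.Hom.f₂_eq_comp _ _ _ hl₁.symm
    have hs : s.f₂ = l.f₂ ≫ ψ.f₂ := TGraph.Hom.f₂_eq_comp _ _ _ hl₁'.symm
    let L : c ⟶ a :=
      { l with
        map_s₀ := by
          change c.s₀ ≫ l₁ = l₀ ≫ a.s₀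
          refine h₁.hom_ext ?_ ?_
          · rw [Category.assoc, hl₁, r.map_s₀, Category.assoc, φ.map_s₀, reassoc_of% hl₀]
          · rw [Category.assoc, hl₁', s.map_s₀, Category.assoc, ψ.map_s₀, reassoc_of% hl₀']
        map_comp := by
          change c.comp ≫ l₁ = l.f₂ ≫ a.comp
          refine h₁.hom_ext ?_ ?_
          · rw [Category.assoc, hl₁, r.map_comp, Category.assoc, φ.map_comp, hr, Category.assoc]
          · rw [Category.assoc, hl₁', s.map_comp, Category.assoc, ψ.map_comp, hs, Category.assoc] }
    exact ⟨L, hom_ext hl₀ hl₁, hom_ext hl₀' hl₁'⟩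

/-- Pullbacks of `T`-multicategories are formed levelwise. The domain map needs that `T` preserves
pullbacks. -/
theorem exists_isPullback (hT : IsCartesianMonad T) {x y z : TMulticategory T} (f : x ⟶ z)
    (g : y ⟶ z) : ∃ (a : TMulticategory T) (φ : a ⟶ x) (ψ : a ⟶ y),
      IsPullback φ.f₀ ψ.f₀ f.f₀ g.f₀ ∧ IsPullback φ.f₁ ψ.f₁ f.f₁ g.f₁ := by
  have h₀ := IsPullback.of_hasPullback f.f₀ g.f₀
  have h₁ := IsPullback.of_hasPullback f.f₁ g.f₁
  have hT₀ := hT.map_isPullback h₀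
  set φ₀ := pullback.fst f.f₀ g.f₀
  set ψ₀ := pullback.snd f.f₀ g.f₀
  set φ₁ := pullback.fst f.f₁ g.f₁
  set ψ₁ := pullback.snd f.f₁ g.f₁
  obtain ⟨d₁, hd₁, hd₁'⟩ := hT₀.exists_lift (φ₁ ≫ x.d₁) (ψ₁ ≫ y.d₁) (by
    rw [Category.assoc, ← f.comm_d₁, reassoc_of% h₁.w, g.comm_d₁, Category.assoc])
  obtain ⟨d₀, hd₀, hd₀'⟩ := h₀.exists_lift (φ₁ ≫ x.d₀) (ψ₁ ≫ y.d₀) (by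
    rw [Category.assoc, ← f.comm_d₀, reassoc_of% h₁.w, g.comm_d₀, Category.assoc])
  let G : TGraph T := ⟨_, _, d₁, d₀⟩
  let φ : TGraph.Hom G x.toTGraph := ⟨φ₀, φ₁, hd₁.symm, hd₀.symm⟩
  let ψ : TGraph.Hom G y.toTGraph := ⟨ψ₀, ψ₁, hd₁'.symm, hd₀'.symm⟩
  have hw₂ : φ.f₂ ≫ f.f₂ = ψ.f₂ ≫ g.f₂ := (TGraph.Hom.isPullback_f₂ hT h₀ h₁).w
  obtain ⟨s₀, hs₀, hs₀'⟩ := h₁.exists_lift (φ₀ ≫ x.s₀) (ψ₀ ≫ y.s₀) (by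
    rw [Category.assoc, f.map_s₀, reassoc_of% h₀.w, ← g.map_s₀, Category.assoc])
  obtain ⟨c, hc, hc'⟩ := h₁.exists_lift (φ.f₂ ≫ x.comp) (ψ.f₂ ≫ y.comp) (by
    rw [Category.assoc, f.map_comp, reassoc_of% hw₂, ← g.map_comp, Category.assoc])
  have natη : ∀ {u w : B} (h : u ⟶ w), T.η.app u ≫ T.map h = h ≫ T.η.app w :=
    fun h => (T.η.naturality h).symm
  let a : TMulticategory T :=
    { G with
      s₀ := s₀
      comp := c
      s₀_d₁ := by
        refine hT₀.hom_ext ?_ ?_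
        · rw [Category.assoc, hd₁, reassoc_of% hs₀, x.s₀_d₁, natη]
        · rw [Category.assoc, hd₁', reassoc_of% hs₀', y.s₀_d₁, natη]
      s₀_d₀ := by
        refine h₀.hom_ext ?_ ?_
        · rw [Category.assoc, hd₀, reassoc_of% hs₀, x.s₀_d₀, Category.comp_id, Category.id_comp]
        · rw [Category.assoc, hd₀', reassoc_of% hs₀', y.s₀_d₀, Category.comp_id, Category.id_comp]
      comp_d₁ := by
        refine hT₀.hom_ext ?_ ?_
        · refine Eq.trans ?_ φ.comp_d₁_naturality.symm
          rw [Category.assoc, hd₁, reassoc_of% hc, x.comp_d₁]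
        · refine Eq.trans ?_ ψ.comp_d₁_naturality.symm
          rw [Category.assoc, hd₁', reassoc_of% hc', y.comp_d₁]
      comp_d₀ := by
        refine h₀.hom_ext ?_ ?_
        · rw [Category.assoc, hd₀, reassoc_of% hc, x.comp_d₀, reassoc_of% φ.f₂_d₀, Category.assoc,
            hd₀]
        · rw [Category.assoc, hd₀', reassoc_of% hc', y.comp_d₀, reassoc_of% ψ.f₂_d₀, Category.assoc,
            hd₀']
      id_comp := by
        refine h₁.hom_ext ?_ ?_
        · exact (φ.id_comp_naturality hs₀ hc _ _).trans ((congrArg (φ₁ ≫ ·) x.id_comp).trans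
            ((Category.comp_id _).trans (Category.id_comp _).symm))
        · exact (ψ.id_comp_naturality hs₀' hc' _ _).trans ((congrArg (ψ₁ ≫ ·) y.id_comp).trans
            ((Category.comp_id _).trans (Category.id_comp _).symm))
      comp_id := by
        refine h₁.hom_ext ?_ ?_
        · exact (φ.comp_id_naturality hs₀ hc _ _).trans ((congrArg (φ₁ ≫ ·) x.comp_id).trans
            ((Category.comp_id _).trans (Category.id_comp _).symm))
        · exact (ψ.comp_id_naturality hs₀' hc' _ _).trans ((congrArg (ψ₁ ≫ ·) y.comp_id).trans
            ((Category.comp_id _).trans (Category.id_comp _).symm))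
      assoc := by
        refine h₁.hom_ext ?_ ?_
        · exact (φ.assoc_left_naturality hc _ _).trans
            ((congrArg (φ.f₃ ≫ ·) x.assoc).trans (φ.assoc_right_naturality hc _ _).symm)
        · exact (ψ.assoc_left_naturality hc' _ _).trans
            ((congrArg (ψ.f₃ ≫ ·) y.assoc).trans (ψ.assoc_right_naturality hc' _ _).symm) }
  exact ⟨a, ⟨φ, hs₀, hc⟩, ⟨ψ, hs₀', hc'⟩, h₀, h₁⟩

theorem hasPullbacks (hT : IsCartesianMonad T) : HasPullbacks (TMulticategory T) := by
  refine @hasPullbacks_of_hasLimit_cospan _ _ fun {x y z f g} => ?_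
  obtain ⟨a, φ, ψ, h₀, h₁⟩ := exists_isPullback hT f g
  exact (isPullback_of_levels hT h₀ h₁).hasPullback

theorem levels_isPullback (hT : IsCartesianMonad T) {a x y z : TMulticategory T} {φ : a ⟶ x}
    {ψ : a ⟶ y} {f : x ⟶ z} {g : y ⟶ z} (sq : IsPullback φ ψ f g) :
    IsPullback φ.f₀ ψ.f₀ f.f₀ g.f₀ ∧ IsPullback φ.f₁ ψ.f₁ f.f₁ g.f₁ := by
  obtain ⟨a', φ', ψ', h₀, h₁⟩ := exists_isPullback hT f g
  have sq' := isPullback_of_levels hT h₀ h₁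
  let e := sq.isoIsPullback _ _ sq'
  have he : φ' = e.inv ≫ φ := (sq.isoIsPullback_inv_fst _ _ sq').symm
  have he' : ψ' = e.inv ≫ ψ := (sq.isoIsPullback_inv_snd _ _ sq').symm
  have hi : ∀ (F : TMulticategory T ⥤ B),
      IsPullback (F.map φ') (F.map ψ') (F.map f) (F.map g) →
      IsPullback (F.map φ) (F.map ψ) (F.map f) (F.map g) := fun F h =>
    h.of_iso (F.mapIso e.symm) (Iso.refl _) (Iso.refl _) (Iso.refl _)
      (by simp [he]) (by simp [he']) (by simp) (by simp)
  exact ⟨hi (objects T) h₀, hi (arrows T) h₁⟩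

/-! ### Descent for multicategories -/

open Descent

/-- Morphisms out of the target of a pullback of `p` are built on objects and on multimorphisms,
where this pullback is an effective epimorphism; compatibility with composition is checked on
composable pairs, where it is an epimorphism. -/
theorem isUniversalEffectiveEpi (hT : IsCartesianMonad T) {x z : TMulticategory T} (p : x ⟶ z)
    (h₀ : IsUniversalEffectiveEpi p.f₀) (h₁ : IsUniversalEffectiveEpi p.f₁)
    (h₂ : IsUniversalEpi p.f₂) : IsUniversalEffectiveEpi p := by
  have := hasPullbacks hT
  intro a e g f k sq
  obtain ⟨sq₀, sq₁⟩ := levels_isPullback hT sq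
  have := h₀ sq₀
  have := h₁ sq₁
  have := h₂ (TGraph.Hom.isPullback_f₂ hT sq₀ sq₁)
  obtain ⟨sqK₀, sqK₁⟩ := levels_isPullback hT (IsPullback.of_hasPullback g g)
  have key : ∀ {t : TMulticategory T} (h : a ⟶ t),
      (∀ {s : TMulticategory T} (r r' : s ⟶ a), r ≫ g = r' ≫ g → r ≫ h = r' ≫ h) →
      ∃ l : e ⟶ t, g ≫ l = h := by
    intro t h hh
    have hK := hh _ _ (pullback.condition (f := g) (g := g))
    obtain ⟨l₀, hl₀⟩ : ∃ l, g.f₀ ≫ l = h.f₀ := ⟨_, EffectiveEpi.fac _ _ fun r r' hr => by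
      obtain ⟨w, rfl, rfl⟩ := sqK₀.exists_lift _ _ hr
      rw [Category.assoc, Category.assoc]
      exact congrArg (w ≫ ·) (congrArg (objects T).map hK)⟩
    obtain ⟨l₁, hl₁⟩ : ∃ l, g.f₁ ≫ l = h.f₁ := ⟨_, EffectiveEpi.fac _ _ fun r r' hr => by
      obtain ⟨w, rfl, rfl⟩ := sqK₁.exists_lift _ _ hr
      rw [Category.assoc, Category.assoc]
      exact congrArg (w ≫ ·) (congrArg (arrows T).map hK)⟩
    let l : TGraph.Hom e.toTGraph t.toTGraph :=
      { f₀ := l₀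
        f₁ := l₁
        comm_d₁ := by
          rw [← cancel_epi g.f₁, reassoc_of% hl₁, h.comm_d₁, reassoc_of% g.comm_d₁, ← T.map_comp,
            hl₀]
        comm_d₀ := by
          rw [← cancel_epi g.f₁, reassoc_of% hl₁, h.comm_d₀, reassoc_of% g.comm_d₀, hl₀] }
    have hl₂ : h.f₂ = g.f₂ ≫ l.f₂ := TGraph.Hom.f₂_eq_comp _ _ _ hl₁.symm
    have hs : e.s₀ ≫ l₁ = l₀ ≫ t.s₀ := by
      rw [← cancel_epi g.f₀, ← reassoc_of% g.map_s₀, hl₁, h.map_s₀, reassoc_of% hl₀]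
    have hc : e.comp ≫ l₁ = l.f₂ ≫ t.comp := by
      rw [← cancel_epi g.f₂, ← reassoc_of% g.map_comp, hl₁, h.map_comp, hl₂, Category.assoc]
    exact ⟨⟨l, hs, hc⟩, hom_ext hl₀ hl₁⟩
  have hg : Epi g := ⟨fun l l' h => hom_ext
    ((cancel_epi g.f₀).1 (congrArg (objects T).map h))
    ((cancel_epi g.f₁).1 (congrArg (arrows T).map h))⟩
  exact ⟨⟨{ desc := fun h hh => (key h hh).choose
            fac := fun h hh => (key h hh).choose_spec
            uniq := fun h hh m hm => by
              rw [← cancel_epi g, hm, (key h hh).choose_spec] }⟩⟩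

/-- A descent datum on a multicategory `a` over `x` is descended on objects and on multimorphisms. The
domain, the codomain and the identities of `a` then descend along effective epimorphisms on these
two levels, the composition along the one on composable pairs, and the associativity law along the
epimorphism on composable triples. -/
theorem descentRelsEffective (hT : IsCartesianMonad T) {x z : TMulticategory T} (p : x ⟶ z)
    (h₀ : IsUniversalEffectiveEpi p.f₀) (h₀' : DescentRelsEffective p.f₀)
    (h₁ : IsUniversalEffectiveEpi p.f₁) (h₁' : DescentRelsEffective p.f₁)
    (h₂ : IsUniversalEffectiveEpi p.f₂) (h₃ : IsUniversalEpi p.f₃) : DescentRelsEffective p := by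
  have := hasPullbacks hT
  intro a f R hR
  obtain ⟨P, π, ξ, sq, hξ⟩ : ∃ (P : TMulticategory T) (π ξ : P ⟶ a),
      IsPullback π (ξ ≫ f) (f ≫ p) p ∧ R π ξ := by
    obtain ⟨ξ, hξ, hξf⟩ := hR.exists_lift (pullback.fst (f ≫ p) p) (pullback.snd (f ≫ p) p)
      pullback.condition
    exact ⟨_, _, ξ, by rw [hξf]; exact IsPullback.of_hasPullback (f ≫ p) p, hξ⟩
  have hR₀ : IsDescentRel p.f₀ f.f₀ fun S r r' =>
      ∃ t : S ⟶ P.x₀, t ≫ π.f₀ = r ∧ t ≫ ξ.f₀ = r' :=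
    hR.map (objects T) (fun _ _ _ _ _ _ _ _ sq => (levels_isPullback hT sq).1) sq hξ
  have hR₁ : IsDescentRel p.f₁ f.f₁ fun S r r' =>
      ∃ t : S ⟶ P.x₁, t ≫ π.f₁ = r ∧ t ≫ ξ.f₁ = r' :=
    hR.map (arrows T) (fun _ _ _ _ _ _ _ _ sq => (levels_isPullback hT sq).2) sq hξ
  obtain ⟨e₀, g₀, k₀, sq₀, hg₀⟩ := h₀' _ _ hR₀
  obtain ⟨e₁, g₁, k₁, sq₁, hg₁⟩ := h₁' _ _ hR₁
  -- Elements of `a` identified in `e` are related, hence the images of an element of `P`.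
  have rel₀ : ∀ {S : B} (r r' : S ⟶ a.x₀), r ≫ g₀ = r' ≫ g₀ →
      ∃ t : S ⟶ P.x₀, t ≫ π.f₀ = r ∧ t ≫ ξ.f₀ = r' :=
    fun r r' => (hR₀.rel_iff_of_isPullback sq₀ hg₀ r r').2
  have rel₁ : ∀ {S : B} (r r' : S ⟶ a.x₁), r ≫ g₁ = r' ≫ g₁ →
      ∃ t : S ⟶ P.x₁, t ≫ π.f₁ = r ∧ t ≫ ξ.f₁ = r' :=
    fun r r' => (hR₁.rel_iff_of_isPullback sq₁ hg₁ r r').2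
  have hπ₀ : π.f₀ ≫ g₀ = ξ.f₀ ≫ g₀ := hg₀ ⟨𝟙 _, Category.id_comp _, Category.id_comp _⟩
  have hπ₁ : π.f₁ ≫ g₁ = ξ.f₁ ≫ g₁ := hg₁ ⟨𝟙 _, Category.id_comp _, Category.id_comp _⟩
  have := h₀ sq₀
  have := h₁ sq₁
  obtain ⟨d₁, hd₁⟩ : ∃ d₁, g₁ ≫ d₁ = a.d₁ ≫ T.map g₀ := ⟨_, EffectiveEpi.fac _ _ fun r r' hr => by
    obtain ⟨t, rfl, rfl⟩ := rel₁ r r' hr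
    simp only [Category.assoc]
    rw [reassoc_of% π.comm_d₁, reassoc_of% ξ.comm_d₁, ← T.map_comp, ← T.map_comp, hπ₀]⟩
  obtain ⟨d₀, hd₀⟩ : ∃ d₀, g₁ ≫ d₀ = a.d₀ ≫ g₀ := ⟨_, EffectiveEpi.fac _ _ fun r r' hr => by
    obtain ⟨t, rfl, rfl⟩ := rel₁ r r' hr
    simp only [Category.assoc]
    rw [reassoc_of% π.comm_d₀, reassoc_of% ξ.comm_d₀, hπ₀]⟩
  obtain ⟨s₀, hs₀⟩ : ∃ s₀, g₀ ≫ s₀ = a.s₀ ≫ g₁ := ⟨_, EffectiveEpi.fac _ _ fun r r' hr => by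
    obtain ⟨t, rfl, rfl⟩ := rel₀ r r' hr
    simp only [Category.assoc]
    rw [← reassoc_of% π.map_s₀, ← reassoc_of% ξ.map_s₀, hπ₁]⟩
  let e : TGraph T := ⟨e₀, e₁, d₁, d₀⟩
  let g : TGraph.Hom a.toTGraph e := ⟨g₀, g₁, hd₁, hd₀⟩
  let k : TGraph.Hom e z.toTGraph :=
    { f₀ := k₀
      f₁ := k₁
      comm_d₁ := by
        rw [← cancel_epi g₁, reassoc_of% sq₁.w, p.comm_d₁, reassoc_of% f.comm_d₁, reassoc_of% hd₁,
          ← T.map_comp, ← T.map_comp, sq₀.w]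
      comm_d₀ := by
        rw [← cancel_epi g₁, reassoc_of% sq₁.w, p.comm_d₀, reassoc_of% f.comm_d₀, reassoc_of% hd₀,
          sq₀.w] }
  have sq₂ : IsPullback g.f₂ f.f₂ k.f₂ p.f₂ := TGraph.Hom.isPullback_f₂ hT sq₀ sq₁
  have := h₂ sq₂
  have : Epi g.f₃ := h₃ (TGraph.Hom.isPullback_f₃ (g := g) (f := f.toHom) (k := k) (p := p.toHom)
    hT sq₀ sq₁)
  have hπ₂ : π.f₂ ≫ g.f₂ = ξ.f₂ ≫ g.f₂ := by
    refine e.x₂_hom_ext ?_ ?_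
    · rw [Category.assoc, Category.assoc, g.f₂_d₀, reassoc_of% π.f₂_d₀, reassoc_of% ξ.f₂_d₀]
      exact congrArg (_ ≫ ·) hπ₁
    · rw [Category.assoc, Category.assoc, g.f₂_d₂, reassoc_of% π.f₂_d₂, reassoc_of% ξ.f₂_d₂,
        ← T.map_comp, ← T.map_comp]
      exact congrArg (fun m => _ ≫ T.map m) hπ₁
  have sqP₂ : IsPullback π.f₂ (ξ ≫ f).f₂ (f ≫ p).f₂ p.f₂ :=
    TGraph.Hom.isPullback_f₂ hT (levels_isPullback hT sq).1 (levels_isPullback hT sq).2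
  rw [comp_f₂, comp_f₂] at sqP₂
  -- Composable pairs with the same image under `g` are related: the pair `(r, r')` factors through
  -- the object of composable pairs of `P`, on which `π` and `ξ` respect composition.
  obtain ⟨c, hc⟩ : ∃ c, g.f₂ ≫ c = a.comp ≫ g₁ := ⟨_, EffectiveEpi.fac _ _ fun r r' hr => by
    obtain ⟨t, ht, ht'⟩ := sqP₂.exists_lift r (r' ≫ f.f₂) (by
      rw [← sq₂.w, reassoc_of% hr, sq₂.w, Category.assoc])
    obtain rfl : t ≫ ξ.f₂ = r' := by
      refine sq₂.hom_ext ?_ ?_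
      · rw [Category.assoc, ← hπ₂, reassoc_of% ht, hr]
      · rw [Category.assoc, ht']
    subst ht
    simp only [Category.assoc]
    rw [← reassoc_of% π.map_comp, ← reassoc_of% ξ.map_comp, hπ₁]⟩
  let E : TMulticategory T :=
    { e with
      s₀ := s₀
      comp := c
      s₀_d₁ := by
        change s₀ ≫ d₁ = T.η.app e₀
        rw [← cancel_epi g₀, reassoc_of% hs₀, hd₁, reassoc_of% a.s₀_d₁]
        exact (T.η.naturality g₀).symm
      s₀_d₀ := by
        change s₀ ≫ d₀ = 𝟙 e₀
        rw [← cancel_epi g₀, reassoc_of% hs₀, hd₀, reassoc_of% a.s₀_d₀, Category.comp_id]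
      comp_d₁ := by
        rw [← cancel_epi g.f₂, ← g.comp_d₁_naturality, ← a.comp_d₁]
        change g.f₂ ≫ c ≫ d₁ = (a.comp ≫ a.d₁) ≫ T.map g₀
        rw [reassoc_of% hc, hd₁, Category.assoc]
      comp_d₀ := by
        change c ≫ d₀ = e.x₂d₀ ≫ d₀
        rw [← cancel_epi g.f₂, reassoc_of% hc, reassoc_of% g.f₂_d₀]
        change a.comp ≫ g₁ ≫ d₀ = a.x₂d₀ ≫ g₁ ≫ d₀
        rw [hd₀, reassoc_of% a.comp_d₀]
      id_comp := (cancel_epi g₁).1 ((g.id_comp_naturality hs₀.symm hc.symm _ _).symm.trans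
        ((congrArg (· ≫ g₁) a.id_comp).trans
          ((Category.id_comp _).trans (Category.comp_id _).symm)))
      comp_id := (cancel_epi g₁).1 ((g.comp_id_naturality hs₀.symm hc.symm _ _).symm.trans
        ((congrArg (· ≫ g₁) a.comp_id).trans
          ((Category.id_comp _).trans (Category.comp_id _).symm)))
      assoc := (cancel_epi g.f₃).1 ((g.assoc_left_naturality hc.symm _ _).symm.trans
        ((congrArg (· ≫ g₁) a.assoc).trans (g.assoc_right_naturality hc.symm _ _))) }
  let γ : a ⟶ E := ⟨g, hs₀.symm, hc.symm⟩
  have hs : s₀ ≫ k₁ = k₀ ≫ z.s₀ := by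
    rw [← cancel_epi g₀, reassoc_of% hs₀, sq₁.w, reassoc_of% f.map_s₀, p.map_s₀,
      reassoc_of% sq₀.w]
  have hk : c ≫ k₁ = k.f₂ ≫ z.comp := by
    rw [← cancel_epi g.f₂, reassoc_of% hc, sq₁.w, reassoc_of% f.map_comp, p.map_comp,
      reassoc_of% sq₂.w]
  let κ : E ⟶ z := ⟨k, hs, hk⟩
  have hγ : π ≫ γ = ξ ≫ γ := hom_ext hπ₀ hπ₁
  refine ⟨E, γ, κ, isPullback_of_levels hT sq₀ sq₁, fun S r r' h => ?_⟩
  obtain ⟨t, rfl, ht⟩ := sq.exists_lift r (r' ≫ f) (by rw [hR.base h, Category.assoc])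
  obtain rfl : t ≫ ξ = r' := hR.eq_of_rel (hR.comp t hξ) h (by rw [Category.assoc, ht])
  rw [Category.assoc, hγ, Category.assoc]

/-- The component on objects of a functor is a retract of its component on multimorphisms, by the
identities and the codomains. -/
def Hom.retractArrow {x z : TMulticategory T} (p : x ⟶ z) : RetractArrow p.f₀ p.f₁ where
  i := Arrow.homMk x.s₀ z.s₀ p.map_s₀
  r := Arrow.homMk x.d₀ z.d₀ p.comm_d₀.symm
  retract := by
    ext
    · exact x.s₀_d₀
    · exact z.s₀_d₀

end TMulticategory

end multicategories

theorem theorem4p5 {B : Type u} [Category.{v} B] [HasFiniteLimits B]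
    (T : CategoryTheory.Monad B) (hT : IsCartesianMonad T)
    {x z : TMulticategory T} (p : x ⟶ z)
    (h₁ : Descent.IsEffectiveDescent (T.map p.f₁))
    (h₂ : Descent.IsDescent (T.map p.f₂))
    (h₃ : Descent.IsAlmostDescent p.f₃) :
    Descent.IsEffectiveDescent p := by
  have : HasPullbacks (TMulticategory T) := TMulticategory.hasPullbacks hT
  have hT₁ : Descent.IsUniversalEffectiveEpi (T.map p.f₁) :=
    Descent.IsDescent.isUniversalEffectiveEpi
      ⟨h₁.1, have := h₁.2; inferInstance, have := h₁.2; inferInstance⟩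
  -- The naturality squares of the unit exhibit `p₁` and `p₂` as pullbacks of `T p₁` and `T p₂`.
  have q₁ : Descent.IsUniversalEffectiveEpi p.f₁ := hT₁.of_isPullback (hT.unit_isPullback p.f₁).flip
  have q₁' : Descent.DescentRelsEffective p.f₁ :=
    h₁.descentRelsEffective.of_isPullback hT₁ (hT.unit_isPullback p.f₁).flip
  have q₀ : Descent.IsUniversalEffectiveEpi p.f₀ := q₁.of_retract (TMulticategory.Hom.retractArrow p)
  have q₀' : Descent.DescentRelsEffective p.f₀ := q₁'.of_retract (TMulticategory.Hom.retractArrow p)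
  have q₂ : Descent.IsUniversalEffectiveEpi p.f₂ :=
    h₂.isUniversalEffectiveEpi.of_isPullback (hT.unit_isPullback p.f₂).flip
  exact Descent.isEffectiveDescent_of_isUniversalEffectiveEpi
    (TMulticategory.isUniversalEffectiveEpi hT p q₀ q₁ fun _ _ _ _ _ sq =>
      have := q₂ sq; inferInstance)
    (TMulticategory.descentRelsEffective hT p q₀ q₀' q₁ q₁' q₂ h₃.isUniversalEpi)
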